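/- Consider a charged particle in the plane $\mathbb R^2$ with position $\mathbf r=(x,y)$, in a constant perpendicular magnetic field $B$, in the symmetric gauge, with units such that $\hbar=m^*=|\text{charge}|=1$ and $B=2$ (magnetic length $\ell_B=B^{-1/2}=1/\sqrt2$). Let $$\pi_x=-\mathrm i\partial_x+y,\qquad \pi_y=-\mathrm i\partial_y-x,\qquad H=\tfrac12(\pi_x^2+\pi_y^2),\qquad a=\tfrac12(-\pi_y+\mathrm i\pi_x),$$ $$\mathbf R=(R_x,R_y),\qquad R_x=x+\tfrac12\pi_y,\qquad R_y=y-\tfrac12\pi_x ,$$ where $\mathbf R$ is the guiding center operator; all these operators act in the sense of tempered distributions. For $n=0,1,2,\dots$ let $n\mathrm{LL}\subset L^2(\mathbb R^2)$ be the $n$-th Landau level, i.e. the eigenspace of $H$ in $L^2(\mathbb R^2)$ for the eigenvalue $B(n+\tfrac12)=2n+1$, let $\mathrm{LLL}=0\mathrm{LL}$, let $\Pi_n$ be the orthogonal projector of $L^2(\mathbb R^2)$ onto $n\mathrm{LL}$, and let $L_n(t)=\sum_{l=0}^n\binom nl\frac{(-t)^l}{l!}$ be the $n$-th Laguerre polynomial.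 Let $n\ge 0$ and $\mathbf q\in\mathbb R^2$. Then $U_n=(n!)^{-1/2}a^n$ restricted to $n\mathrm{LL}$ is a unitary map $n\mathrm{LL}\to\mathrm{LLL}$; the operator $\mathbf q\cdot\mathbf R=q_xR_x+q_yR_y$, with domain $\{\psi\in L^2(\mathbb R^2):(\mathbf q\cdot\mathbf R)\psi\in L^2(\mathbb R^2)\}$, generates a unique strongly continuous one-parameter unitary group $t\mapsto e^{\mathrm it\,\mathbf q\cdot\mathbf R}$ on $L^2(\mathbb R^2)$; and, with $e^{\mathrm i\mathbf q\cdot\mathbf r}$ denoting the multiplication operator on $L^2(\mathbb R^2)$, the following identities between operators on $\mathrm{LLL}$ hold: $$U_n\,\Pi_n\,e^{\mathrm i\mathbf q\cdot\mathbf r}\,\Pi_n\,U_n^{-1}=L_n\!\left(\tfrac{|\mathbf q|^2}{4}\right)e^{-|\mathbf q|^2/8}\,\Pi_0\,e^{\mathrm i\mathbf q\cdot\mathbf R}\,\Pi_0=L_n\!\left(\tfrac{|\mathbf q|^2}{4}\right)\Pi_0\,e^{\mathrm i\mathbf q\cdot\mathbf r}\,\Pi_0 .$$ -/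

import Mathlib

open MeasureTheory
open scoped SchwartzMap LineDeriv ENNReal

namespace LandauLevels

/-- The plane `ℝ²`, with its Euclidean norm. -/
abbrev Plane := EuclideanSpace ℝ (Fin 2)

/-- The one-particle Hilbert space `L²(ℝ²)`. -/
noncomputable abbrev L2Plane := Lp ℂ 2 (volume : Measure Plane)

/-- Operators on tempered distributions. All differential operators below act on the whole of
`𝓢'(ℝ²)`, which contains `L²(ℝ²)`. -/
abbrev DistOp := 𝓢'(Plane, ℂ) →L[ℂ] 𝓢'(Plane, ℂ)

/-- The inclusion of `L²(ℝ²)` into the tempered distributions. -/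
noncomputable def toDist : L2Plane →L[ℂ] 𝓢'(Plane, ℂ) :=
  Lp.toTemperedDistributionCLM ℂ (volume : Measure Plane) 2

/-- The coordinate operators: multiplication by `x = r 0` and `y = r 1`. -/
noncomputable def pos (j : Fin 2) : DistOp :=
  TemperedDistribution.smulLeftCLM ℂ (fun r : Plane => ((r j : ℝ) : ℂ))

/-- The partial derivatives `∂_x` (`j = 0`) and `∂_y` (`j = 1`), in the sense of distributions. -/
noncomputable def partialD (j : Fin 2) : DistOp :=
  LineDeriv.lineDerivOpCLM ℂ 𝓢'(Plane, ℂ) (EuclideanSpace.single j (1 : ℝ))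

/-! Units: `ħ = m* = |charge| = 1` and magnetic field `B = 2`, that is `ℓ_B² = 1 / 2`,
in the symmetric gauge. -/

/-- Kinetic momentum `π_x = -i ∂_x + (B/2) y`. -/
noncomputable def kinX : DistOp := -(Complex.I • partialD 0) + pos 1

/-- Kinetic momentum `π_y = -i ∂_y - (B/2) x`. -/
noncomputable def kinY : DistOp := -(Complex.I • partialD 1) - pos 0

/-- The magnetic Hamiltonian `H = (π_x² + π_y²) / 2`. -/
noncomputable def hamiltonian : DistOp :=
  (1 / 2 : ℂ) • (kinX ∘L kinX + kinY ∘L kinY)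

/-- The annihilation operator `a = (ℓ_B / √2) (-π_y + i π_x)` of the cyclotron oscillator. -/
noncomputable def annihilation : DistOp :=
  (1 / 2 : ℂ) • (-kinY + Complex.I • kinX)

/-- The first component `R_x = x + ℓ_B² π_y` of the guiding center operator. -/
noncomputable def guidingX : DistOp := pos 0 + (1 / 2 : ℂ) • kinY

/-- The second component `R_y = y - ℓ_B² π_x` of the guiding center operator. -/
noncomputable def guidingY : DistOp := pos 1 - (1 / 2 : ℂ) • kinX

/-- `q · R = q_x R_x + q_y R_y`. -/
noncomputable def dotGuiding (q : Plane) : DistOp :=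
  ((q 0 : ℝ) : ℂ) • guidingX + ((q 1 : ℝ) : ℂ) • guidingY

/-- The `n`-th Landau level: the eigenspace of `H` in `L²(ℝ²)` for the eigenvalue
`B (n + 1/2) = 2 n + 1`. -/
noncomputable def level (n : ℕ) : Submodule ℂ L2Plane where
  carrier := {ψ | hamiltonian (toDist ψ) = (2 * (n : ℂ) + 1) • toDist ψ}
  add_mem' := by
    intro ψ φ hψ hφ
    simp only [Set.mem_ofPred_eq, map_add, smul_add] at *
    rw [hψ, hφ]
  zero_mem' := by
    change hamiltonian (toDist 0) = ((2 * (n : ℂ) + 1) • toDist) 0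
    rw [map_zero, map_zero, map_zero]
  smul_mem' := by
    intro c ψ hψ
    simp only [Set.mem_ofPred_eq, map_smul] at *
    rw [hψ, smul_comm]

theorem level_isClosed (n : ℕ) : IsClosed (level n : Set L2Plane) := by
  have h1 : Continuous fun ψ : L2Plane => hamiltonian (toDist ψ) :=
    hamiltonian.continuous.comp toDist.continuous
  have h2 : Continuous fun ψ : L2Plane => ((2 * (n : ℂ) + 1) • toDist) ψ :=
    ((2 * (n : ℂ) + 1) • toDist).continuous
  exact isClosed_eq h1 h2

instance level_completeSpace (n : ℕ) : CompleteSpace (level n) :=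
  (level_isClosed n).completeSpace_coe

/-- `Π_n T Π_n`, as an operator on the `n`-th Landau level, where `Π_n` is the orthogonal projector
of `L²(ℝ²)` onto that level. -/
noncomputable def compress (n : ℕ) (T : L2Plane →L[ℂ] L2Plane) : level n →L[ℂ] level n :=
  (level n).orthogonalProjectionOnto ∘L T ∘L (level n).subtypeL

/-- `U` is the restriction of `(n!)^(-1/2) a^n` to the `n`-th Landau level, as a unitary map onto
the lowest Landau level. -/
def IsLadderUnitary (n : ℕ) (U : level n ≃ₗᵢ[ℂ] level 0) : Prop :=
  ∀ ψ : level n, toDist (U ψ : L2Plane) =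
    (((Real.sqrt (n.factorial : ℝ))⁻¹ : ℝ) : ℂ) • (annihilation ^ n) (toDist (ψ : L2Plane))

theorem memLp_planeWave (q : Plane) :
    MemLp (fun r : Plane => Complex.exp (Complex.I * ((inner ℝ q r : ℝ) : ℂ))) ∞
      (volume : Measure Plane) := by
  refine memLp_top_of_bound ?_ 1 (Filter.Eventually.of_forall fun r => ?_)
  · exact (by fun_prop : Continuous fun r : Plane =>
      Complex.exp (Complex.I * ((inner ℝ q r : ℝ) : ℂ))).aestronglyMeasurable
  · rw [mul_comm, Complex.norm_exp_ofReal_mul_I]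

/-- The multiplication operator `e^{i q · r}` on `L²(ℝ²)`. -/
noncomputable def planeWave (q : Plane) : L2Plane →L[ℂ] L2Plane :=
  (ContinuousLinearMap.mul ℂ ℂ).holderL (volume : Measure Plane) ∞ 2 2 (memLp_planeWave q).toLp

theorem planeWave_apply (q : Plane) (ψ : L2Plane) :
    planeWave q ψ =ᵐ[volume]
      fun r => Complex.exp (Complex.I * ((inner ℝ q r : ℝ) : ℂ)) * ψ r := by
  have h := (ContinuousLinearMap.mul ℂ ℂ).coeFn_holder (r := 2) (memLp_planeWave q).toLp ψ
  filter_upwards [h, (memLp_planeWave q).coeFn_toLp] with r h1 h2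
  rw [h2] at h1
  exact h1

/-- `W t = e^{i t A}` for all real `t`: `W` is a strongly continuous one-parameter unitary group on
`L²(ℝ²)` whose self-adjoint generator (in the sense of Stone's theorem) is the operator `A`, on
the domain of all `ψ ∈ L²(ℝ²)` with `A ψ ∈ L²(ℝ²)`. -/
structure IsExpGroup (A : DistOp) (W : ℝ → L2Plane →L[ℂ] L2Plane) : Prop where
  zero : W 0 = ContinuousLinearMap.id ℂ L2Plane
  add : ∀ s t, W (s + t) = W s ∘L W t
  isometry : ∀ t ψ, ‖W t ψ‖ = ‖ψ‖
  continuous : ∀ ψ, Continuous fun t => W t ψ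
  generator : ∀ ψ φ : L2Plane,
    HasDerivAt (fun t => W t ψ) (Complex.I • φ) 0 ↔ toDist φ = A (toDist ψ)

/-- The Laguerre polynomial `L_n`. -/
noncomputable def laguerre (n : ℕ) (t : ℝ) : ℝ :=
  ∑ l ∈ Finset.range (n + 1), (n.choose l : ℝ) * ((-t) ^ l / (l.factorial : ℝ))

end LandauLevels

open LandauLevels

/-! The plane carries two commuting oscillators, cyclotron `(a, a†)` and guiding center `(b, b†)`,
all four given on Schwartz functions by `ladder σ τ`. On Schwartz functions `H = 2 a†a + 1`, and the
Gaussian `g` is killed by both `a` and `b`. The normalized vectors `a†ⁿ b†ᵐ g` are orthonormal by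
the commutation relations and total in `L²` (`eq_zero_of_toDist_rawState_eq_zero`); those with fixed
`n` form a Hilbert basis of the `n`-th level. Since `aⁿ a†ⁿ = n!` on the kernel of `a`, the operator
`(n!)^(-1/2) aⁿ` maps the state `(n, m)` to `(0, m)`, whence the unitary `ladderUnitary`.

Write `i q·r = i q·R + (c a† - c̄ a)` with `c = waveDisplacement q`, `|c|² = |q|²/4`; the two
summands commute. The first generates an explicit phase-space translation, `magneticTranslation`. It
has the required generator by `isExpGroup_shift`, and any other such group agrees with it because
the norm of the difference of two orbits is conserved (`IsExpGroup.unique`).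

The plane wave displaces `a` by `c` and `a†` by `c̄`, so moving ladder operators through it turns
its matrix elements in the `n`-th level into `L_n(|c|²)` times those in the lowest level
(`form_raise_pow_displaced_raise_pow`). Within the lowest level the cyclotron factor `exp (c a† - c̄
a)` contributes only `exp (-|c|²/2)` (`testForm_cyclotron_shift`), leaving `e^{i q·R}`
(`testForm_planeWave`). A bounded operator on a level is determined by its matrix elements in the
basis, which gives both identities. -/

namespace LandauLevels

/-! ### Abstract ladder algebra and the Laguerre polynomial -/

section Ladder

variable {M : Type*} [AddCommGroup M] [Module ℂ M] {A A' E : Module.End ℂ M}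

theorem lower_raise_pow (hc : ∀ f, A (A' f) = A' (A f) + f) {f : M} (hf : A f = 0) (n : ℕ) :
    A ((A' ^ n) f) = (n : ℂ) • (A' ^ (n - 1)) f := by
  induction n with
  | zero => simp [hf]
  | succ n ih =>
    rw [pow_succ', Module.End.mul_apply, hc, ih, map_smul]
    rcases n with _ | n
    · simp
    · simp only [Nat.add_sub_cancel]
      rw [← Module.End.mul_apply, ← pow_succ']
      push_cast
      module

theorem lower_pow_raise_pow (hc : ∀ f, A (A' f) = A' (A f) + f) {f : M} (hf : A f = 0) (k n : ℕ) :
    (A ^ k) ((A' ^ n) f) = (n.descFactorial k : ℂ) • (A' ^ (n - k)) f := by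
  induction k with
  | zero => simp
  | succ k ih =>
    rw [pow_succ', Module.End.mul_apply, ih, map_smul, lower_raise_pow hc hf, smul_smul,
      Nat.descFactorial_succ, Nat.sub_sub, mul_comm]
    push_cast
    rfl

variable {s : M →ₗ⋆[ℂ] M →ₗ[ℂ] ℂ}

theorem form_raise_pow (ha : ∀ f g, s (A' f) g = s f (A g)) (n : ℕ) (f g : M) :
    s ((A' ^ n) f) g = s f ((A ^ n) g) := by
  induction n generalizing g with
  | zero => simp
  | succ n ih =>
    rw [pow_succ', Module.End.mul_apply, ha, ih, pow_succ, Module.End.mul_apply]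

theorem form_raise_pow_raise_pow (hc : ∀ f, A (A' f) = A' (A f) + f)
    (ha : ∀ f g, s (A' f) g = s f (A g)) (ha' : ∀ f g, s (A f) g = s f (A' g)) {f h : M}
    (hf : A f = 0) (hh : A h = 0) (n m : ℕ) :
    s ((A' ^ n) f) ((A' ^ m) h) = if n = m then (n.factorial : ℂ) * s f h else 0 := by
  rw [form_raise_pow ha, lower_pow_raise_pow hc hh, map_smul, smul_eq_mul]
  rcases lt_trichotomy n m with h1 | h1 | h1
  -- A creation operator is left over on the right; moved to the left it becomes `A` and kills `f`.
  · obtain ⟨k, rfl⟩ := Nat.exists_eq_add_of_lt h1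
    rw [show n + k + 1 - n = k + 1 by omega, pow_succ', Module.End.mul_apply, ← ha', hf,
      if_neg (by omega)]
    simp
  · subst h1
    simp [Nat.descFactorial_self]
  · rw [Nat.descFactorial_eq_zero_iff_lt.mpr h1, if_neg h1.ne']
    simp

/-- `E A' = A' E - c̄ E`, and the term with `A'` on the outside vanishes because `A f = 0`; each
power thus costs a factor `-c̄`. -/
theorem form_displaced_raise_pow {c : ℂ} (ha' : ∀ f g, s (A f) g = s f (A' g))
    (hE' : ∀ f, A' (E f) = E (A' f) + (starRingEnd ℂ c) • E f) {f : M} (hf : A f = 0) (h : M)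
    (n : ℕ) : s f (E ((A' ^ n) h)) = (-(starRingEnd ℂ c)) ^ n * s f (E h) := by
  induction n with
  | zero => simp
  | succ n ih =>
    have h1 := hE' ((A' ^ n) h)
    rw [pow_succ', Module.End.mul_apply, ← sub_eq_iff_eq_add.mpr h1, map_sub, ← ha', hf, map_smul,
      ih, map_zero, smul_eq_mul, LinearMap.zero_apply, pow_succ']
    ring

theorem lower_pow_displaced {c : ℂ} (hE : ∀ f, A (E f) = E (A f) + c • E f) (n : ℕ) (f : M) :
    (A ^ n) (E f) = E (((A + c • (1 : Module.End ℂ M)) ^ n) f) := by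
  induction n generalizing f with
  | zero => simp
  | succ n ih =>
    rw [pow_succ, Module.End.mul_apply, hE, ← map_smul, ← map_add, ih, pow_succ,
      Module.End.mul_apply]
    simp

/-- Moving `A'ⁿ` to the right and through `E` gives `E (A + c)ⁿ A'ⁿ h`. In the binomial expansion
the term `cˡ Aⁿ⁻ˡ` leaves `n!/l!` times `A'ˡ h`, and the remaining creation operators yield
`(-c̄)ˡ`; the sum is the Laguerre polynomial at `|c|²`. -/
theorem form_raise_pow_displaced_raise_pow {c : ℂ} (hc : ∀ f, A (A' f) = A' (A f) + f)
    (ha : ∀ f g, s (A' f) g = s f (A g)) (ha' : ∀ f g, s (A f) g = s f (A' g))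
    (hE : ∀ f, A (E f) = E (A f) + c • E f)
    (hE' : ∀ f, A' (E f) = E (A' f) + (starRingEnd ℂ c) • E f)
    {f h : M} (hf : A f = 0) (hh : A h = 0) (n : ℕ) :
    s ((A' ^ n) f) (E ((A' ^ n) h)) =
      (n.factorial : ℂ) * ((laguerre n (Complex.normSq c) : ℝ) : ℂ) * s f (E h) := by
  have hcomm : Commute A (c • (1 : Module.End ℂ M)) := (Commute.one_right A).smul_right c
  rw [form_raise_pow ha, lower_pow_displaced hE, add_comm A, hcomm.symm.add_pow,
    LinearMap.sum_apply, map_sum, map_sum, laguerre]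
  push_cast
  rw [Finset.mul_sum, Finset.sum_mul]
  refine Finset.sum_congr rfl fun l hl => ?_
  have hl' : l ≤ n := Nat.lt_succ_iff.mp (Finset.mem_range.mp hl)
  have h1 : ((c • (1 : Module.End ℂ M)) ^ l * A ^ (n - l) * (n.choose l : Module.End ℂ M))
      ((A' ^ n) h) = (c ^ l * n.choose l * n.descFactorial (n - l) : ℂ) • (A' ^ l) h := by
    rw [smul_pow, one_pow, Module.End.mul_apply, Module.End.mul_apply, Module.End.natCast_apply,
      ← Nat.cast_smul_eq_nsmul ℂ, map_smul, lower_pow_raise_pow hc hh, Nat.sub_sub_self hl']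
    simp only [LinearMap.smul_apply, Module.End.one_apply]
    module
  rw [h1, map_smul, map_smul, form_displaced_raise_pow ha' hE' hf, smul_eq_mul]
  -- The falling factorial is `n!/l!`, the origin of the `1/l!` in the Laguerre coefficients.
  have h2 : (l.factorial : ℂ) * (n.descFactorial (n - l) : ℂ) = n.factorial := by
    have := Nat.factorial_mul_descFactorial (n := n) (k := n - l) (Nat.sub_le _ _)
    rw [Nat.sub_sub_self hl'] at this
    exact_mod_cast this
  have h3 : (l.factorial : ℂ) ≠ 0 := by exact_mod_cast l.factorial_ne_zero
  rw [← h2, neg_pow, neg_pow (Complex.normSq c : ℂ), ← Complex.mul_conj, mul_pow]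
  field_simp

end Ladder

/-! ### First-order operators on Schwartz functions and their transposes -/

/-- Schwartz functions on the plane. -/
abbrev Test := 𝓢(Plane, ℂ)

theorem coord_hasTemperateGrowth (j : Fin 2) :
    Function.HasTemperateGrowth (fun r : Plane => ((r j : ℝ) : ℂ)) :=
  (Complex.ofRealCLM ∘L (EuclideanSpace.proj j : Plane →L[ℝ] ℝ)).hasTemperateGrowth

/-- Multiplication by a coordinate. -/
noncomputable def testPos (j : Fin 2) : Module.End ℂ Test :=
  (SchwartzMap.smulLeftCLM ℂ (fun r : Plane => ((r j : ℝ) : ℂ))).toLinearMap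

/-- Partial derivatives of Schwartz functions. -/
noncomputable def testD (j : Fin 2) : Module.End ℂ Test :=
  (LineDeriv.lineDerivOpCLM ℂ Test (EuclideanSpace.single j (1 : ℝ) : Plane)).toLinearMap

theorem testPos_apply (j : Fin 2) (f : Test) (r : Plane) : testPos j f r = (r j : ℂ) * f r := by
  change SchwartzMap.smulLeftCLM ℂ (fun r : Plane => ((r j : ℝ) : ℂ)) f r = _
  rw [SchwartzMap.smulLeftCLM_apply_apply (coord_hasTemperateGrowth j), smul_eq_mul]

theorem testD_apply (j : Fin 2) (f : Test) (r : Plane) :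
    testD j f r = fderiv ℝ f r (EuclideanSpace.single j 1) := by
  change (∂_{(EuclideanSpace.single j (1 : ℝ) : Plane)} f) r = _
  rw [SchwartzMap.lineDerivOp_apply_eq_fderiv]

theorem testD_testPos (j k : Fin 2) (f : Test) :
    testD j (testPos k f) = testPos k (testD j f) + (if j = k then (1 : ℂ) else 0) • f := by
  ext r
  have h1 : (testPos k f : Plane → ℂ) = fun r => ((EuclideanSpace.proj k r : ℝ) : ℂ) * f r := by
    ext r
    rw [testPos_apply]
    rfl
  have h2 : HasFDerivAt (fun r : Plane => ((EuclideanSpace.proj k r : ℝ) : ℂ))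
      (Complex.ofRealCLM ∘L (EuclideanSpace.proj k : Plane →L[ℝ] ℝ)) r :=
    (Complex.ofRealCLM ∘L (EuclideanSpace.proj k : Plane →L[ℝ] ℝ)).hasFDerivAt
  rw [testD_apply, h1, (h2.fun_mul (f.hasFDerivAt r)).fderiv, add_apply, add_apply, testPos_apply,
    testD_apply, smul_apply]
  by_cases hjk : j = k
  · subst hjk; simp [mul_comm]
  · simp [hjk, Ne.symm hjk, mul_comm]

theorem testPos_comm (j k : Fin 2) (f : Test) : testPos j (testPos k f) = testPos k (testPos j f) := by
  ext r
  simp only [testPos_apply]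
  ring

theorem testD_comm (j k : Fin 2) (f : Test) : testD j (testD k f) = testD k (testD j f) := by
  ext r
  have key : ∀ j k : Fin 2, testD j (testD k f) r = fderiv ℝ (fderiv ℝ f) r
      (EuclideanSpace.single j 1) (EuclideanSpace.single k 1) := by
    intro j k
    have h1 : (testD k f : Plane → ℂ) = fun r => fderiv ℝ f r (EuclideanSpace.single k 1) := by
      ext r
      rw [testD_apply]
    have h2 : HasFDerivAt (fderiv ℝ f) (fderiv ℝ (fderiv ℝ f) r) r :=
      ((f.smooth 2).fderiv_right (m := 1) (by norm_num)).differentiable (by norm_num)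
        |>.differentiableAt.hasFDerivAt
    rw [testD_apply, h1, (h2.clm_apply (hasFDerivAt_const _ _)).fderiv]
    simp
  rw [key, key]
  refine second_derivative_symmetric (𝕜 := ℝ) (f := f) (f' := fderiv ℝ f) (x := r)
    (fun y => f.hasFDerivAt y) ?_ _ _
  exact ((f.smooth 2).fderiv_right (m := 1) (by norm_num)).differentiable (by norm_num)
    |>.differentiableAt.hasFDerivAt

/-- The first-order operators `(x + i σ y + τ (∂_x + i σ ∂_y)) / 2` on Schwartz functions. The
annihilation and creation operators of the cyclotron motion are those with `(σ, τ) = (1, 1)` and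
`(-1, -1)`, those of the guiding center are those with `(σ, τ) = (-1, 1)` and `(1, -1)`. -/
noncomputable def ladder (σ τ : ℝ) : Module.End ℂ Test :=
  (1 / 2 : ℂ) • (testPos 0 + (Complex.I * σ) • testPos 1 +
    (τ : ℂ) • (testD 0 + (Complex.I * σ) • testD 1))

theorem ladder_comm (σ τ σ' τ' : ℝ) (f : Test) : ladder σ τ (ladder σ' τ' f) =
    ladder σ' τ' (ladder σ τ f) + (((τ - τ') * (1 - σ * σ') / 4 : ℝ) : ℂ) • f := by
  simp only [ladder, LinearMap.smul_apply, LinearMap.add_apply, map_add, map_smul, testD_testPos,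
    smul_add, smul_smul, testPos_comm 1 0, testD_comm 1 0]
  simp only [Fin.isValue, ↓reduceIte, one_ne_zero, zero_ne_one]
  push_cast
  match_scalars <;> (ring_nf; try (simp only [Complex.I_sq]; ring))

theorem pos_apply_apply (j : Fin 2) (T : 𝓢'(Plane, ℂ)) (f : Test) :
    pos j T f = T (testPos j f) := rfl

theorem partialD_apply_apply (j : Fin 2) (T : 𝓢'(Plane, ℂ)) (f : Test) :
    partialD j T f = -T (testD j f) :=
  map_neg T _

theorem dist_add_apply (P Q : DistOp) (T : 𝓢'(Plane, ℂ)) (f : Test) :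
    (P + Q) T f = P T f + Q T f := rfl

theorem dist_sub_apply (P Q : DistOp) (T : 𝓢'(Plane, ℂ)) (f : Test) :
    (P - Q) T f = P T f - Q T f := rfl

theorem dist_neg_apply (P : DistOp) (T : 𝓢'(Plane, ℂ)) (f : Test) : (-P) T f = -P T f := rfl

theorem dist_smul_apply (c : ℂ) (P : DistOp) (T : 𝓢'(Plane, ℂ)) (f : Test) :
    (c • P) T f = c * P T f := rfl

theorem dist_comp_apply (P Q : DistOp) (T : 𝓢'(Plane, ℂ)) (f : Test) :
    (P ∘L Q) T f = P (Q T) f := rfl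

/-- Transposition reverses the sign of derivatives, hence of `τ`: the transpose of the cyclotron `a`
is the guiding center `b†`. -/
theorem annihilation_apply_apply (T : 𝓢'(Plane, ℂ)) (f : Test) :
    annihilation T f = T (ladder 1 (-1) f) := by
  simp only [annihilation, kinX, kinY, ladder, dist_add_apply, dist_sub_apply, dist_neg_apply,
    dist_smul_apply, pos_apply_apply, partialD_apply_apply, LinearMap.smul_apply,
    LinearMap.add_apply, map_smul, map_add, smul_eq_mul]
  push_cast
  ring_nf
  simp only [Complex.I_sq]
  ring

theorem hamiltonian_apply_apply (T : 𝓢'(Plane, ℂ)) (f : Test) :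
    hamiltonian T f = T ((2 : ℂ) • ladder 1 (-1) (ladder (-1) 1 f) + f) := by
  simp only [hamiltonian, kinX, kinY, ladder, dist_add_apply, dist_sub_apply, dist_neg_apply,
    dist_smul_apply, dist_comp_apply, pos_apply_apply, partialD_apply_apply, LinearMap.smul_apply,
    LinearMap.add_apply, map_smul, map_add, smul_eq_mul, testD_testPos, testPos_comm 1 0,
    testD_comm 1 0]
  simp only [Fin.isValue, ↓reduceIte, one_ne_zero, zero_ne_one]
  push_cast
  ring_nf
  simp only [Complex.I_sq]
  ring

/-- The transpose of `q · R` on Schwartz functions. -/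
noncomputable def testGuiding (q : Plane) : Module.End ℂ Test :=
  (1 / 2 : ℂ) • (((q 0 : ℝ) : ℂ) • (testPos 0 + Complex.I • testD 1) +
    ((q 1 : ℝ) : ℂ) • (testPos 1 - Complex.I • testD 0))

theorem dotGuiding_apply_apply (q : Plane) (T : 𝓢'(Plane, ℂ)) (f : Test) :
    dotGuiding q T f = T (testGuiding q f) := by
  simp only [dotGuiding, guidingX, guidingY, testGuiding, kinX, kinY, dist_add_apply,
    dist_sub_apply, dist_neg_apply, dist_smul_apply, pos_apply_apply, partialD_apply_apply,
    LinearMap.smul_apply, LinearMap.add_apply, LinearMap.sub_apply, map_smul, map_add, map_sub,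
    smul_eq_mul]
  ring

/-! ### The bilinear and sesquilinear pairings on `L²` -/

theorem toDist_apply (ψ : L2Plane) (f : Test) : toDist ψ f = ∫ r, f r * ψ r :=
  Lp.toTemperedDistribution_apply ψ f

theorem toDist_injective : Function.Injective toDist :=
  LinearMap.ker_eq_bot.mp
    (Lp.ker_toTemperedDistributionCLM_eq_bot (F := ℂ) (μ := (volume : Measure Plane)) (p := 2))

theorem toDist_toLp_apply (f g : Test) : toDist (f.toLp 2) g = ∫ r, g r * f r := by
  rw [toDist_apply]
  refine integral_congr_ae ?_
  filter_upwards [f.coeFn_toLp 2 (volume : Measure Plane)] with r hr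
  rw [hr]

theorem toDist_toLp_testPos (j : Fin 2) (f g : Test) :
    toDist ((testPos j f).toLp 2) g = toDist (f.toLp 2) (testPos j g) := by
  simp only [toDist_toLp_apply, testPos_apply]
  congr 1 with r
  ring

theorem toDist_toLp_testD (j : Fin 2) (f g : Test) :
    toDist ((testD j f).toLp 2) g = -toDist (f.toLp 2) (testD j g) := by
  simp only [toDist_toLp_apply]
  exact SchwartzMap.integral_mul_lineDerivOp_right_eq_neg_left g f _

theorem toLp_add (f g : Test) :
    (f + g).toLp 2 (volume : Measure Plane) =
      f.toLp 2 (volume : Measure Plane) + g.toLp 2 (volume : Measure Plane) :=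
  (SchwartzMap.toLpCLM ℂ ℂ 2 (volume : Measure Plane)).map_add f g

theorem toLp_smul (c : ℂ) (f : Test) :
    (c • f).toLp 2 (volume : Measure Plane) = c • f.toLp 2 (volume : Measure Plane) :=
  (SchwartzMap.toLpCLM ℂ ℂ 2 (volume : Measure Plane)).map_smul c f

theorem toDist_add_apply (ψ φ : L2Plane) (f : Test) :
    toDist (ψ + φ) f = toDist ψ f + toDist φ f := by
  rw [map_add]; rfl

theorem toDist_smul_apply (c : ℂ) (ψ : L2Plane) (f : Test) :
    toDist (c • ψ) f = c * toDist ψ f := by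
  rw [map_smul]; rfl

theorem toDist_toLp_ladder (σ τ : ℝ) (f g : Test) :
    toDist ((ladder σ τ f).toLp 2) g = toDist (f.toLp 2) (ladder σ (-τ) g) := by
  simp only [ladder, LinearMap.smul_apply, LinearMap.add_apply, toLp_add, toLp_smul,
    toDist_add_apply, toDist_smul_apply, toDist_toLp_testPos, toDist_toLp_testD]
  simp only [map_add, map_smul, smul_eq_mul]
  push_cast
  ring

theorem annihilation_toDist (f : Test) :
    annihilation (toDist (f.toLp 2)) = toDist ((ladder 1 1 f).toLp 2) := by
  ext g
  rw [annihilation_apply_apply, toDist_toLp_ladder]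

theorem annihilation_pow_toDist (n : ℕ) (f : Test) :
    (annihilation ^ n) (toDist (f.toLp 2)) = toDist ((((ladder 1 1) ^ n) f).toLp 2) := by
  induction n with
  | zero => rfl
  | succ n ih =>
    rw [pow_succ', mul_apply_eq_comp, ih, annihilation_toDist, pow_succ',
      Module.End.mul_apply]

theorem hamiltonian_toDist (f : Test) : hamiltonian (toDist (f.toLp 2)) =
    toDist (((2 : ℂ) • ladder (-1) (-1) (ladder 1 1 f) + f).toLp 2) := by
  ext g
  rw [hamiltonian_apply_apply, toLp_add, toLp_smul, toDist_add_apply, toDist_smul_apply,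
    toDist_toLp_ladder, toDist_toLp_ladder, map_add, map_smul, smul_eq_mul, neg_neg]

/-- Complex conjugation of Schwartz functions. -/
noncomputable def testConj (f : Test) : Test :=
  SchwartzMap.postcompCLM (𝕜 := ℝ) (Complex.conjCLE : ℂ →L[ℝ] ℂ) f

theorem testConj_apply (f : Test) (r : Plane) : testConj f r = starRingEnd ℂ (f r) := rfl

theorem testConj_add (f g : Test) : testConj (f + g) = testConj f + testConj g := by
  ext r; simp [testConj_apply]

theorem testConj_smul (c : ℂ) (f : Test) : testConj (c • f) = starRingEnd ℂ c • testConj f := by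
  ext r; simp [testConj_apply]

theorem testConj_testPos (j : Fin 2) (f : Test) : testConj (testPos j f) = testPos j (testConj f) := by
  ext r; simp [testConj_apply, testPos_apply]

theorem testConj_testD (j : Fin 2) (f : Test) : testConj (testD j f) = testD j (testConj f) := by
  ext r
  have h : HasFDerivAt (testConj f) ((Complex.conjCLE : ℂ →L[ℝ] ℂ) ∘L fderiv ℝ f r) r :=
    (Complex.conjCLE : ℂ →L[ℝ] ℂ).hasFDerivAt.comp r (f.hasFDerivAt r)
  rw [testD_apply, h.fderiv, testConj_apply, testD_apply]
  rfl

theorem testConj_ladder (σ τ : ℝ) (f : Test) :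
    testConj (ladder σ τ f) = ladder (-σ) τ (testConj f) := by
  simp only [ladder, LinearMap.smul_apply, LinearMap.add_apply, testConj_add, testConj_smul,
    testConj_testPos, testConj_testD]
  simp [map_ofNat (starRingEnd ℂ) 2]

theorem inner_toLp (f : Test) (ψ : L2Plane) :
    inner ℂ (f.toLp 2) ψ = toDist ψ (testConj f) := by
  rw [toDist_apply, L2.inner_def]
  refine integral_congr_ae ?_
  filter_upwards [f.coeFn_toLp 2 (volume : Measure Plane)] with r hr
  rw [hr, testConj_apply]
  simp [mul_comm]

/-- The inner product of `L²(ℝ²)` as a sesquilinear form on Schwartz functions. -/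
noncomputable def testForm : Test →ₗ⋆[ℂ] Test →ₗ[ℂ] ℂ :=
  LinearMap.mk₂'ₛₗ (starRingEnd ℂ) (RingHom.id ℂ) (fun f g => inner ℂ (f.toLp 2) (g.toLp 2))
    (fun f g h => by rw [toLp_add, inner_add_left])
    (fun c f g => by rw [toLp_smul, inner_smul_left]; rfl)
    (fun f g h => by rw [toLp_add, inner_add_right])
    (fun c f g => by rw [toLp_smul, inner_smul_right]; rfl)

theorem testForm_apply (f g : Test) : testForm f g = inner ℂ (f.toLp 2) (g.toLp 2) := rfl

/-- The adjoint is conjugation (which flips `σ`) combined with transposition (which flips `τ`). -/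
theorem testForm_ladder (σ τ : ℝ) (f g : Test) :
    testForm (ladder σ τ f) g = testForm f (ladder (-σ) (-τ) g) := by
  rw [testForm_apply, testForm_apply, inner_toLp, inner_toLp, testConj_ladder, toDist_toLp_ladder,
    neg_neg]

/-! ### The Gaussian ground state -/

theorem one_add_pow_mul_exp_neg_sq_le (N : ℕ) {x : ℝ} (hx : 0 ≤ x) :
    (1 + x) ^ N * Real.exp (-(x ^ 2 / 2)) ≤ N.factorial * Real.exp (3 / 2) := by
  have h1 : (1 + x) ^ N ≤ N.factorial * Real.exp (1 + x) := by
    have := Real.pow_div_factorial_le_exp (1 + x) (by positivity) N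
    rwa [div_le_iff₀' (by positivity)] at this
  calc (1 + x) ^ N * Real.exp (-(x ^ 2 / 2))
      ≤ N.factorial * Real.exp (1 + x) * Real.exp (-(x ^ 2 / 2)) := by gcongr
    _ = N.factorial * Real.exp (1 + x - x ^ 2 / 2) := by rw [mul_assoc, ← Real.exp_add]; ring_nf
    _ ≤ _ := by
      gcongr
      -- `1 + x - x²/2 = 3/2 - (x - 1)²/2`.
      nlinarith [sq_nonneg (x - 1)]

/-- The Faà di Bruno bound for `exp (-t)` composed with `|r|²/2`: every derivative of the outer
function has the size of the Gaussian itself, and those of the inner one grow polynomially. -/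
theorem exists_norm_iteratedFDeriv_gaussian_le (n : ℕ) : ∃ (N : ℕ) (C : ℝ), 0 ≤ C ∧ ∀ r : Plane,
    ‖iteratedFDeriv ℝ n (fun r : Plane => Real.exp ((-1) * (‖r‖ ^ 2 / 2))) r‖ ≤
      C * (1 + ‖r‖) ^ N * Real.exp (-(‖r‖ ^ 2 / 2)) := by
  have hq : Function.HasTemperateGrowth (fun r : Plane => ‖r‖ ^ 2 / 2) := by
    have h : (fun r : Plane => ‖r‖ ^ 2 / 2) = fun r => (1 / 2 : ℝ) * ‖r‖ ^ 2 := by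
      ext r
      ring
    rw [h]
    exact (Function.HasTemperateGrowth.const (E := Plane) (1 / 2 : ℝ)).mul
      (Function.hasTemperateGrowth_norm_sq Plane)
  obtain ⟨k, C, hC, h⟩ := hq.norm_iteratedFDeriv_le_uniform n
  refine ⟨k * n, n.factorial * (1 + C) ^ n, by positivity, fun r => ?_⟩
  -- The composition bound asks for `D ^ i` at order `i`; taking `1 + C` instead of `C` makes `D ≥
  -- 1`, so that `D ≤ D ^ i` for `i ≥ 1`.
  have hD : (1 : ℝ) ≤ (1 + C) * (1 + ‖r‖) ^ k :=
    one_le_mul_of_one_le_of_one_le (by linarith) (one_le_pow₀ (by linarith [norm_nonneg r]))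
  have key := norm_iteratedFDeriv_comp_le (𝕜 := ℝ) (n := n) (N := n)
    (g := fun t : ℝ => Real.exp ((-1) * t)) (f := fun r : Plane => ‖r‖ ^ 2 / 2)
    (C := Real.exp (-(‖r‖ ^ 2 / 2))) (D := (1 + C) * (1 + ‖r‖) ^ k) (by fun_prop)
    (hq.1.of_le (by exact_mod_cast le_top)) le_rfl r ?_ ?_
  · refine key.trans (le_of_eq ?_)
    rw [mul_pow, pow_mul]
    ring
  · intro i _
    rw [norm_iteratedFDeriv_eq_norm_iteratedDeriv, iteratedDeriv_exp_const_mul]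
    simp
  · intro i hi hin
    calc _ ≤ C * (1 + ‖r‖) ^ k := h i hin r
      _ ≤ (1 + C) * (1 + ‖r‖) ^ k := by gcongr; linarith
      _ ≤ _ := le_self_pow₀ hD (by omega)

/-- The Gaussian `exp (-|r|² / 2)` as a Schwartz function. -/
noncomputable def realGaussian : 𝓢(Plane, ℝ) where
  toFun r := Real.exp ((-1) * (‖r‖ ^ 2 / 2))
  smooth' := by
    exact (contDiff_const.mul ((contDiff_norm_sq ℝ).div_const 2)).exp
  decay' k n := by
    obtain ⟨N, C, hC, h⟩ := exists_norm_iteratedFDeriv_gaussian_le n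
    refine ⟨C * ((k + N).factorial * Real.exp (3 / 2)), fun r => ?_⟩
    calc _ ≤ (1 + ‖r‖) ^ k * (C * (1 + ‖r‖) ^ N * Real.exp (-(‖r‖ ^ 2 / 2))) := by
          gcongr
          · linarith
          · exact h r
      _ = C * ((1 + ‖r‖) ^ (k + N) * Real.exp (-(‖r‖ ^ 2 / 2))) := by rw [pow_add]; ring
      _ ≤ _ := by
        exact mul_le_mul_of_nonneg_left (one_add_pow_mul_exp_neg_sq_le _ (norm_nonneg r)) hC

/-- The Gaussian `exp (-|r|² / 2)` as a complex Schwartz function. -/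
noncomputable def gaussian : Test :=
  SchwartzMap.postcompCLM (𝕜 := ℝ) Complex.ofRealCLM realGaussian

theorem gaussian_apply (r : Plane) : gaussian r = ((Real.exp (-(‖r‖ ^ 2 / 2)) : ℝ) : ℂ) := by
  change ((Real.exp ((-1) * (‖r‖ ^ 2 / 2)) : ℝ) : ℂ) = _
  rw [neg_one_mul]

theorem testD_gaussian (j : Fin 2) : testD j gaussian = -testPos j gaussian := by
  ext r
  have h0 : HasFDerivAt (fun r : Plane => ‖r‖ ^ 2) (2 • innerSL ℝ r) r :=
    (hasStrictFDerivAt_norm_sq r).hasFDerivAt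
  have h1 : HasFDerivAt gaussian (Complex.ofRealCLM ∘L
      (Real.exp ((-(1 / 2) : ℝ) * ‖r‖ ^ 2) • ((-(1 / 2) : ℝ) • (2 • innerSL ℝ r)))) r := by
    have := Complex.ofRealCLM.hasFDerivAt.comp r ((h0.const_mul (-(1 / 2) : ℝ)).exp)
    refine this.congr_of_eventuallyEq (Filter.Eventually.of_forall fun r => ?_)
    rw [gaussian_apply]
    simp only [Function.comp, Complex.ofRealCLM_apply]
    ring_nf
  rw [testD_apply, h1.fderiv, neg_apply, testPos_apply, gaussian_apply]
  simp [EuclideanSpace.inner_single_right]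
  ring_nf

theorem ladder_one_gaussian (σ : ℝ) : ladder σ 1 gaussian = 0 := by
  simp only [ladder, LinearMap.smul_apply, LinearMap.add_apply, testD_gaussian]
  push_cast
  module

theorem testConj_gaussian : testConj gaussian = gaussian := by
  ext r
  rw [testConj_apply, gaussian_apply, Complex.conj_ofReal]

theorem gaussian_toLp_ne_zero : gaussian.toLp 2 (volume : Measure Plane) ≠ 0 := by
  intro h
  have h0 : (0 : Test).toLp 2 (volume : Measure Plane) = 0 :=
    (SchwartzMap.toLpCLM ℂ ℂ 2 (volume : Measure Plane)).map_zero
  have h1 : gaussian = 0 := SchwartzMap.injective_toLp 2 (volume : Measure Plane) (h.trans h0.symm)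
  have h2 := gaussian_apply 0
  rw [h1] at h2
  simp at h2

/-- The normalized Gaussian. -/
noncomputable def ground : Test :=
  ((‖gaussian.toLp 2 (volume : Measure Plane)‖⁻¹ : ℝ) : ℂ) • gaussian

theorem ladder_one_ground (σ : ℝ) : ladder σ 1 ground = 0 := by
  rw [ground, map_smul, ladder_one_gaussian, smul_zero]

theorem testConj_ground : testConj ground = ground := by
  rw [ground, testConj_smul, testConj_gaussian, Complex.conj_ofReal]

theorem testForm_ground : testForm ground ground = 1 := by
  have h : ‖gaussian.toLp 2 (volume : Measure Plane)‖ ≠ 0 := norm_ne_zero_iff.mpr gaussian_toLp_ne_zero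
  rw [testForm_apply, ground, toLp_smul, inner_smul_left, inner_smul_right,
    inner_self_eq_norm_sq_to_K, Complex.conj_ofReal]
  have h' : (‖gaussian.toLp 2 (volume : Measure Plane)‖ : ℂ) ≠ 0 := by exact_mod_cast h
  push_cast
  simp only [RCLike.ofReal_eq_complex_ofReal]
  field_simp

/-! ### Angular momentum states and their orthonormality -/

/-- The unnormalized angular momentum states `a†ⁿ b†ᵐ g` of the Landau levels, where `g` is the
normalized Gaussian and `b†` the creation operator of the guiding center. -/
noncomputable def rawState (n m : ℕ) : Test :=
  ((ladder (-1) (-1)) ^ n) (((ladder 1 (-1)) ^ m) ground)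

theorem raise_rawState (n m : ℕ) : ladder (-1) (-1) (rawState n m) = rawState (n + 1) m := by
  rw [rawState, rawState, pow_succ', Module.End.mul_apply]

theorem ladder_commute {σ τ σ' τ' : ℝ} (h : (τ - τ') * (1 - σ * σ') = 0) :
    Commute (ladder σ τ) (ladder σ' τ') := by
  refine LinearMap.ext fun f => ?_
  rw [Module.End.mul_apply, Module.End.mul_apply, ladder_comm, h]
  simp

theorem rawState_eq (n m : ℕ) :
    rawState n m = ((ladder 1 (-1)) ^ m) (((ladder (-1) (-1)) ^ n) ground) := by
  have : Commute ((ladder (-1) (-1)) ^ n) ((ladder 1 (-1)) ^ m) :=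
    (ladder_commute (by ring)).pow_pow n m
  rw [rawState, ← Module.End.mul_apply, this.eq, Module.End.mul_apply]

theorem raise_center_rawState (n m : ℕ) : ladder 1 (-1) (rawState n m) = rawState n (m + 1) := by
  rw [rawState_eq, rawState_eq, pow_succ', Module.End.mul_apply]

theorem comm_cyclotron (f : Test) :
    ladder 1 1 (ladder (-1) (-1) f) = ladder (-1) (-1) (ladder 1 1 f) + f := by
  rw [ladder_comm]
  norm_num

theorem comm_center (f : Test) :
    ladder (-1) 1 (ladder 1 (-1) f) = ladder 1 (-1) (ladder (-1) 1 f) + f := by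
  rw [ladder_comm]
  norm_num

theorem lower_center_pow_ground (m : ℕ) :
    ladder 1 1 (((ladder 1 (-1)) ^ m) ground) = 0 := by
  have : Commute (ladder 1 1) ((ladder 1 (-1)) ^ m) := (ladder_commute (by ring)).pow_right m
  rw [← Module.End.mul_apply, this.eq, Module.End.mul_apply, ladder_one_ground, map_zero]

theorem lower_cyclotron_pow_ground (n : ℕ) :
    ladder (-1) 1 (((ladder (-1) (-1)) ^ n) ground) = 0 := by
  have : Commute (ladder (-1) 1) ((ladder (-1) (-1)) ^ n) := (ladder_commute (by ring)).pow_right n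
  rw [← Module.End.mul_apply, this.eq, Module.End.mul_apply, ladder_one_ground, map_zero]

theorem lower_rawState (n m : ℕ) :
    ladder 1 1 (rawState n m) = (n : ℂ) • rawState (n - 1) m :=
  lower_raise_pow comm_cyclotron (lower_center_pow_ground m) n

theorem lower_center_rawState (n m : ℕ) :
    ladder (-1) 1 (rawState n m) = (m : ℂ) • rawState n (m - 1) := by
  rw [rawState_eq, rawState_eq]
  exact lower_raise_pow comm_center (lower_cyclotron_pow_ground n) m

/-- Conjugation exchanges `a†` and `b†` and fixes the real ground state. This is why the indices are
swapped whenever an inner product is rewritten as a distributional pairing. -/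
theorem testConj_rawState (n m : ℕ) : testConj (rawState n m) = rawState m n := by
  have h : ∀ (σ : ℝ) (k : ℕ) (f : Test), testConj (((ladder σ (-1)) ^ k) f) =
      ((ladder (-σ) (-1)) ^ k) (testConj f) := by
    intro σ k f
    induction k with
    | zero => rfl
    | succ k ih =>
      rw [pow_succ', Module.End.mul_apply, testConj_ladder, ih, pow_succ', Module.End.mul_apply]
  rw [rawState, h, h, testConj_ground, neg_neg, rawState_eq]

theorem testForm_rawState (n m n' m' : ℕ) : testForm (rawState n m) (rawState n' m') =
    if n = n' ∧ m = m' then (n.factorial * m.factorial : ℂ) else 0 := by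
  have h : ∀ (σ τ : ℝ) f g, testForm (ladder σ τ f) g = testForm f (ladder (-σ) (-τ) g) :=
    testForm_ladder
  rw [rawState, rawState, form_raise_pow_raise_pow comm_cyclotron
    (fun f g => by simpa using h (-1) (-1) f g) (fun f g => by simpa using h 1 1 f g)
    (lower_center_pow_ground m) (lower_center_pow_ground m'),
    form_raise_pow_raise_pow comm_center
    (fun f g => by simpa using h 1 (-1) f g) (fun f g => by simpa using h (-1) 1 f g)
    (ladder_one_ground _) (ladder_one_ground _), testForm_ground]
  by_cases h1 : n = n' <;> by_cases h2 : m = m' <;> simp [h1, h2]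

theorem sqrt_factorial_ne_zero (n : ℕ) : ((Real.sqrt (n.factorial : ℝ) : ℝ) : ℂ) ≠ 0 := by
  have : 0 < Real.sqrt (n.factorial : ℝ) := Real.sqrt_pos.mpr (by exact_mod_cast n.factorial_pos)
  exact_mod_cast this.ne'

theorem sqrt_factorial_sq (n : ℕ) :
    ((Real.sqrt (n.factorial : ℝ) : ℝ) : ℂ) ^ 2 = (n.factorial : ℂ) := by
  have := Real.sq_sqrt (Nat.cast_nonneg (α := ℝ) n.factorial)
  exact_mod_cast this

/-- The normalized angular momentum states of the Landau levels. -/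
noncomputable def state (n m : ℕ) : Test :=
  (((Real.sqrt (n.factorial : ℝ))⁻¹ * (Real.sqrt (m.factorial : ℝ))⁻¹ : ℝ) : ℂ) • rawState n m

theorem testForm_state (n m n' m' : ℕ) :
    testForm (state n m) (state n' m') = if n = n' ∧ m = m' then 1 else 0 := by
  rw [state, state, testForm_apply, toLp_smul, toLp_smul, inner_smul_left, inner_smul_right,
    ← testForm_apply, testForm_rawState, Complex.conj_ofReal]
  split_ifs with h
  · obtain ⟨rfl, rfl⟩ := h
    rw [← sqrt_factorial_sq, ← sqrt_factorial_sq]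
    have h1 := sqrt_factorial_ne_zero n
    have h2 := sqrt_factorial_ne_zero m
    push_cast
    field_simp
  · simp

/-- The normalized angular momentum states as elements of `L²(ℝ²)`. -/
noncomputable def stateL2 (p : ℕ × ℕ) : L2Plane := (state p.1 p.2).toLp 2

theorem orthonormal_stateL2 : Orthonormal ℂ stateL2 := by
  rw [orthonormal_iff_ite]
  rintro ⟨n, m⟩ ⟨n', m'⟩
  simp only [stateL2, ← testForm_apply, testForm_state, Prod.mk.injEq]

/-! ### Completeness of the angular momentum states -/

/-- Multiplication of Schwartz functions by the linear form `q · r`. -/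
noncomputable def testDot (q : Plane) : Module.End ℂ Test :=
  ((q 0 : ℝ) : ℂ) • testPos 0 + ((q 1 : ℝ) : ℂ) • testPos 1

theorem testDot_apply (q : Plane) (f : Test) (r : Plane) :
    testDot q f r = ((inner ℝ q r : ℝ) : ℂ) * f r := by
  have h : inner ℝ q r = q 0 * r 0 + q 1 * r 1 := by
    simp [PiLp.inner_apply, Fin.sum_univ_two, mul_comm]
  rw [h, testDot, LinearMap.add_apply, LinearMap.smul_apply, LinearMap.smul_apply, add_apply,
    smul_apply, smul_apply, testPos_apply, testPos_apply]
  push_cast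
  simp only [smul_eq_mul]
  ring

theorem testDot_pow_apply (q : Plane) (k : ℕ) (f : Test) (r : Plane) :
    ((testDot q) ^ k) f r = ((inner ℝ q r : ℝ) : ℂ) ^ k * f r := by
  induction k with
  | zero => simp
  | succ k ih => rw [pow_succ', Module.End.mul_apply, testDot_apply, ih]; ring

/-- The span of the angular momentum states. -/
noncomputable def rawSpan : Submodule ℂ Test :=
  Submodule.span ℂ (Set.range fun p : ℕ × ℕ => rawState p.1 p.2)

theorem rawState_mem_rawSpan (n m : ℕ) : rawState n m ∈ rawSpan :=
  Submodule.subset_span ⟨(n, m), rfl⟩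

theorem map_mem_rawSpan {L : Module.End ℂ Test} (h : ∀ n m, L (rawState n m) ∈ rawSpan) {f : Test}
    (hf : f ∈ rawSpan) : L f ∈ rawSpan := by
  have : rawSpan ≤ rawSpan.comap L := by
    rw [rawSpan, Submodule.span_le]
    rintro _ ⟨p, rfl⟩
    exact h p.1 p.2
  exact this hf

theorem testDot_mem_rawSpan (q : Plane) {f : Test} (hf : f ∈ rawSpan) : testDot q f ∈ rawSpan := by
  have h1 : ladder 1 1 f ∈ rawSpan := map_mem_rawSpan (fun n m => by
    rw [lower_rawState]; exact rawSpan.smul_mem _ (rawState_mem_rawSpan _ _)) hf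
  have h2 : ladder (-1) 1 f ∈ rawSpan := map_mem_rawSpan (fun n m => by
    rw [lower_center_rawState]; exact rawSpan.smul_mem _ (rawState_mem_rawSpan _ _)) hf
  have h3 : ladder (-1) (-1) f ∈ rawSpan := map_mem_rawSpan (fun n m => by
    rw [raise_rawState]; exact rawState_mem_rawSpan _ _) hf
  have h4 : ladder 1 (-1) f ∈ rawSpan := map_mem_rawSpan (fun n m => by
    rw [raise_center_rawState]; exact rawState_mem_rawSpan _ _) hf
  -- With `z = x + iy` one has `z = a + b†` and `z̄ = a† + b`, while `q·r` is the real part of `z`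
  -- times the conjugate of `q_x + i q_y`.
  have h : testDot q f = ((1 / 2 : ℂ) * (q 0 - Complex.I * q 1)) • (ladder 1 1 f + ladder 1 (-1) f) +
      ((1 / 2 : ℂ) * (q 0 + Complex.I * q 1)) • (ladder (-1) (-1) f + ladder (-1) 1 f) := by
    simp only [testDot, ladder, LinearMap.smul_apply, LinearMap.add_apply]
    push_cast
    match_scalars <;> ring_nf
    simp only [Complex.I_sq]
    ring
  rw [h]
  exact rawSpan.add_mem (rawSpan.smul_mem _ (rawSpan.add_mem h1 h4))
    (rawSpan.smul_mem _ (rawSpan.add_mem h3 h2))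

theorem ground_mem_rawSpan : ground ∈ rawSpan := by
  simpa [rawState] using rawState_mem_rawSpan 0 0

theorem testDot_pow_ground_mem_rawSpan (q : Plane) (k : ℕ) :
    ((testDot q) ^ k) ground ∈ rawSpan := by
  induction k with
  | zero => simpa using ground_mem_rawSpan
  | succ k ih =>
    rw [pow_succ', Module.End.mul_apply]
    exact testDot_mem_rawSpan q ih

/-- Completing the square: `e^{±q·r} g(r) = e^{|q|²/2} g(r ∓ q)`. This dominates the exponential
series by translated Gaussians, which are square integrable. -/
theorem exp_abs_inner_mul_gaussian_le (q r : Plane) :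
    Real.exp |inner ℝ q r| * ‖gaussian r‖ ≤ Real.exp (‖q‖ ^ 2 / 2) *
      (‖SchwartzMap.compSubConstCLM ℂ q gaussian r‖ +
        ‖SchwartzMap.compSubConstCLM ℂ (-q) gaussian r‖) := by
  have hn : ∀ r, ‖gaussian r‖ = Real.exp (-(‖r‖ ^ 2 / 2)) := fun r => by
    rw [gaussian_apply, Complex.norm_real, Real.norm_of_nonneg (Real.exp_nonneg _)]
  have h1 := norm_sub_sq_real r q
  have h2 := norm_add_sq_real r q
  have hs : inner ℝ r q = inner ℝ q r := real_inner_comm q r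
  rw [SchwartzMap.compSubConstCLM_apply, SchwartzMap.compSubConstCLM_apply, hn, hn, hn,
    sub_neg_eq_add, mul_add, ← Real.exp_add, ← Real.exp_add, ← Real.exp_add, h1, h2, hs]
  rcases abs_cases (inner ℝ q r) with ⟨h, -⟩ | ⟨h, -⟩
  · rw [h]
    refine le_add_of_le_of_nonneg (Real.exp_le_exp.mpr ?_) (Real.exp_nonneg _)
    linarith
  · rw [h]
    refine le_add_of_nonneg_of_le (Real.exp_nonneg _) (Real.exp_le_exp.mpr ?_)
    linarith

theorem integrable_test_mul (f : Test) (ψ : L2Plane) : Integrable (fun r => f r * ψ r) :=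
  (f.memLp 2 (volume : Measure Plane)).integrable_mul (Lp.memLp ψ)

theorem integrable_exp_abs_inner_mul_gaussian_mul (q : Plane) (ψ : L2Plane) :
    Integrable (fun r => Real.exp |inner ℝ q r| * ‖gaussian r * ψ r‖) := by
  have h1 := (integrable_test_mul (SchwartzMap.compSubConstCLM ℂ q gaussian) ψ).norm
  have h2 := (integrable_test_mul (SchwartzMap.compSubConstCLM ℂ (-q) gaussian) ψ).norm
  refine ((h1.add h2).const_mul (Real.exp (‖q‖ ^ 2 / 2))).mono' ?_
    (Filter.Eventually.of_forall fun r => ?_)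
  · have h3 : Continuous fun r : Plane => Real.exp |inner ℝ q r| := by fun_prop
    exact h3.aestronglyMeasurable.mul (integrable_test_mul gaussian ψ).aestronglyMeasurable.norm
  · rw [Real.norm_of_nonneg (by positivity), norm_mul, ← mul_assoc]
    simp only [Pi.add_apply, norm_mul]
    rw [← add_mul, ← mul_assoc]
    exact mul_le_mul_of_nonneg_right (exp_abs_inner_mul_gaussian_le q r) (norm_nonneg _)

/-- The exponential series is integrated term by term; the Gaussian weight absorbs the dominating
function `e^{|q·r|}`. -/
theorem integral_exp_inner_mul_eq_zero {ψ : L2Plane} (q : Plane)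
    (h : ∀ k : ℕ, ∫ r, ((inner ℝ q r : ℝ) : ℂ) ^ k * (gaussian r * ψ r) = 0) :
    ∫ r, Complex.exp (Complex.I * ((inner ℝ q r : ℝ) : ℂ)) * (gaussian r * ψ r) = 0 := by
  have hs : ∀ x : ℝ, HasSum (fun k : ℕ => |x| ^ k / (k.factorial : ℝ)) (Real.exp |x|) := fun x => by
    rw [Real.exp_eq_exp_ℝ]
    exact NormedSpace.expSeries_div_hasSum_exp |x|
  have hc : ∀ z : ℂ, HasSum (fun k : ℕ => z ^ k / (k.factorial : ℂ)) (Complex.exp z) := fun z => by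
    rw [Complex.exp_eq_exp_ℂ]
    exact NormedSpace.expSeries_div_hasSum_exp z
  have key := hasSum_integral_of_dominated_convergence (μ := (volume : Measure Plane))
    (F := fun (k : ℕ) r => (Complex.I * ((inner ℝ q r : ℝ) : ℂ)) ^ k / (k.factorial : ℂ) *
      (gaussian r * ψ r))
    (f := fun r => Complex.exp (Complex.I * ((inner ℝ q r : ℝ) : ℂ)) * (gaussian r * ψ r))
    (bound := fun k r => |inner ℝ q r| ^ k / (k.factorial : ℝ) * ‖gaussian r * ψ r‖)
    (fun k => ?_) (fun k => ?_) ?_ ?_ ?_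
  · refine key.unique ?_
    have h0 : ∀ (k : ℕ), ∫ r, (Complex.I * ((inner ℝ q r : ℝ) : ℂ)) ^ k / (k.factorial : ℂ) *
        (gaussian r * ψ r) = 0 := fun k => ?_
    · simp only [h0]
      exact hasSum_zero
    have : ∀ r : Plane, (Complex.I * ((inner ℝ q r : ℝ) : ℂ)) ^ k / (k.factorial : ℂ) *
        (gaussian r * ψ r) = (Complex.I ^ k / (k.factorial : ℂ)) *
          (((inner ℝ q r : ℝ) : ℂ) ^ k * (gaussian r * ψ r)) := fun r => by ring
    simp only [this]
    rw [integral_const_mul, h, mul_zero]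
  · have h3 : Continuous fun r : Plane =>
        (Complex.I * ((inner ℝ q r : ℝ) : ℂ)) ^ k / (k.factorial : ℂ) := by fun_prop
    exact h3.aestronglyMeasurable.mul (integrable_test_mul gaussian ψ).aestronglyMeasurable
  · refine Filter.Eventually.of_forall fun r => ?_
    simp
  · exact Filter.Eventually.of_forall fun r => ((hs _).mul_right _).summable
  · refine (integrable_exp_abs_inner_mul_gaussian_mul q ψ).congr
      (Filter.Eventually.of_forall fun r => ?_)
    exact ((hs _).mul_right _).tsum_eq.symm
  · exact Filter.Eventually.of_forall fun r => (hc _).mul_right _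

open scoped FourierTransform in
theorem ae_eq_zero_of_integral_exp_inner_mul_eq_zero {h : Plane → ℂ} (hi : Integrable h)
    (hz : ∀ q : Plane, ∫ r, Complex.exp (Complex.I * ((inner ℝ q r : ℝ) : ℂ)) * h r = 0) :
    h =ᵐ[volume] 0 := by
  have hF : ∀ w : Plane, 𝓕 h w = 0 := by
    intro w
    -- The Fourier kernel is `e^{-2πi w·r}`, so the wave vector is `-2πw`.
    rw [Real.fourier_eq', ← hz ((-(2 * Real.pi)) • w)]
    congr 1 with r
    rw [real_inner_smul_left, real_inner_comm, smul_eq_mul]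
    congr 2
    push_cast
    ring
  -- Self-adjointness of the Fourier transform, with `χ` written as the transform of its inverse
  -- transform.
  have hS : ∀ χ : Test, ∫ r, h r * χ r = 0 := by
    intro χ
    have := VectorFourier.integral_fourierIntegral_smul_eq_flip (L := innerₗ Plane)
      (μ := volume) (ν := volume) (f := h) (g := ((𝓕⁻ χ : Test) : Plane → ℂ))
      Real.continuous_fourierChar continuous_inner hi (𝓕⁻ χ : Test).integrable
    have h1 : ∀ w, VectorFourier.fourierIntegral Real.fourierChar volume (innerₗ Plane) h w = 0 := hF
    have h2 : VectorFourier.fourierIntegral Real.fourierChar volume (innerₗ Plane).flip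
        (𝓕⁻ χ : Test) = (χ : Plane → ℂ) := by
      rw [flip_innerₗ]
      change ((𝓕 (𝓕⁻ χ : Test) : Test) : Plane → ℂ) = χ
      rw [FourierTransform.fourier_fourierInv_eq]
    rw [h2] at this
    simp only [h1, smul_eq_mul, zero_mul, integral_zero] at this
    exact this.symm
  refine ae_eq_zero_of_integral_contDiff_smul_eq_zero hi.locallyIntegrable fun g hg hc => ?_
  have hc' : HasCompactSupport fun r => (g r : ℂ) := hc.comp_left (g := Complex.ofReal) rfl
  have hg' := Complex.ofRealCLM.contDiff.comp hg
  rw [← hS (hc'.toSchwartzMap hg')]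
  congr 1 with r
  rw [Complex.real_smul, mul_comm]
  rfl

/-- The span contains all `(q·r)ᵏ g`, so the Fourier transform of `g ψ` vanishes; then `g ψ = 0`
almost everywhere, and `g` has no zeros. -/
theorem eq_zero_of_toDist_rawState_eq_zero {ψ : L2Plane}
    (h : ∀ n m, toDist ψ (rawState n m) = 0) : ψ = 0 := by
  have h1 : ∀ f ∈ rawSpan, toDist ψ f = 0 := by
    intro f hf
    refine Submodule.span_induction (p := fun f _ => toDist ψ f = 0) ?_ (map_zero _) ?_ ?_ hf
    · rintro _ ⟨p, rfl⟩
      exact h p.1 p.2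
    · intro f g _ _ hf hg
      rw [map_add, hf, hg, add_zero]
    · intro c f _ hf
      rw [map_smul, hf, smul_zero]
  have h2 : ∀ (q : Plane) (k : ℕ), ∫ r, ((inner ℝ q r : ℝ) : ℂ) ^ k * (gaussian r * ψ r) = 0 := by
    intro q k
    have h3 := h1 _ (testDot_pow_ground_mem_rawSpan q k)
    rw [ground, map_smul, map_smul, smul_eq_mul, mul_eq_zero] at h3
    have h4 : toDist ψ (((testDot q) ^ k) gaussian) = 0 := by
      refine h3.resolve_left ?_
      have := inv_ne_zero (norm_ne_zero_iff.mpr gaussian_toLp_ne_zero)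
      exact_mod_cast this
    rw [toDist_apply] at h4
    simpa only [testDot_pow_apply, mul_assoc] using h4
  have h5 := ae_eq_zero_of_integral_exp_inner_mul_eq_zero (integrable_test_mul gaussian ψ)
    fun q => integral_exp_inner_mul_eq_zero q (h2 q)
  rw [Lp.eq_zero_iff_ae_eq_zero]
  filter_upwards [h5] with r hr
  refine (mul_eq_zero.mp hr).resolve_left ?_
  rw [gaussian_apply]
  exact_mod_cast (Real.exp_pos _).ne'

theorem inner_stateL2 (n m : ℕ) (ψ : L2Plane) : inner ℂ (stateL2 (n, m)) ψ =
    (((Real.sqrt (n.factorial : ℝ))⁻¹ * (Real.sqrt (m.factorial : ℝ))⁻¹ : ℝ) : ℂ) *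
      toDist ψ (rawState m n) := by
  rw [stateL2, inner_toLp, state, testConj_smul, testConj_rawState, map_smul, Complex.conj_ofReal,
    smul_eq_mul]

theorem eq_zero_of_inner_stateL2_eq_zero {ψ : L2Plane}
    (h : ∀ n m, inner ℂ (stateL2 (n, m)) ψ = 0) : ψ = 0 := by
  refine eq_zero_of_toDist_rawState_eq_zero fun m n => ?_
  have h1 := h n m
  rw [inner_stateL2, mul_eq_zero] at h1
  refine h1.resolve_left ?_
  push_cast
  exact mul_ne_zero (inv_ne_zero (sqrt_factorial_ne_zero n)) (inv_ne_zero (sqrt_factorial_ne_zero m))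

/-! ### Bases of the Landau levels and the ladder unitary -/

theorem mem_level_iff {n : ℕ} {ψ : L2Plane} :
    ψ ∈ level n ↔ hamiltonian (toDist ψ) = (2 * (n : ℂ) + 1) • toDist ψ := Iff.rfl

theorem number_rawState (n m : ℕ) :
    (2 : ℂ) • ladder (-1) (-1) (ladder 1 1 (rawState n m)) + rawState n m =
      (2 * (n : ℂ) + 1) • rawState n m := by
  rw [lower_rawState, map_smul, raise_rawState]
  rcases n with _ | n
  · simp
  · rw [Nat.add_sub_cancel]
    module

theorem number_center_rawState (n m : ℕ) :
    (2 : ℂ) • ladder 1 (-1) (ladder (-1) 1 (rawState n m)) + rawState n m =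
      (2 * (m : ℂ) + 1) • rawState n m := by
  rw [lower_center_rawState, map_smul, raise_center_rawState]
  rcases m with _ | m
  · simp
  · rw [Nat.add_sub_cancel]
    module

theorem stateL2_mem_level (n m : ℕ) : stateL2 (n, m) ∈ level n := by
  rw [mem_level_iff, stateL2, hamiltonian_toDist, state, map_smul, map_smul, smul_comm (2 : ℂ),
    ← smul_add, number_rawState, smul_comm, toLp_smul, map_smul]

/-- The eigenvalue equation holds only as distributions, so it is tested against the conjugate state
`rawState m k`. The transposed Hamiltonian is `2 b†b + 1` and gives `2k + 1` there, which differs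
from `2n + 1`. -/
theorem inner_stateL2_eq_zero_of_mem_level {n k : ℕ} (hk : k ≠ n) (m : ℕ) {ψ : L2Plane}
    (hψ : ψ ∈ level n) : inner ℂ (stateL2 (k, m)) ψ = 0 := by
  have h1 := congrArg (fun T : 𝓢'(Plane, ℂ) => T (rawState m k)) (mem_level_iff.mp hψ)
  have h2 : (2 * (k : ℂ) + 1) * toDist ψ (rawState m k) =
      (2 * (n : ℂ) + 1) * toDist ψ (rawState m k) := by
    rw [← smul_eq_mul, ← map_smul, ← number_center_rawState, ← hamiltonian_apply_apply]
    exact h1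
  rw [inner_stateL2]
  refine mul_eq_zero_of_right _ ?_
  by_contra h3
  have h4 := mul_right_cancel₀ h3 h2
  have h5 : (k : ℂ) = n := by linear_combination h4 / 2
  exact hk (by exact_mod_cast h5)

/-- The angular momentum states of the `n`-th Landau level. -/
noncomputable def levelState (n m : ℕ) : level n := ⟨stateL2 (n, m), stateL2_mem_level n m⟩

theorem orthonormal_levelState (n : ℕ) : Orthonormal ℂ (levelState n) := by
  rw [orthonormal_iff_ite]
  intro m m'
  have := orthonormal_iff_ite.mp orthonormal_stateL2 (n, m) (n, m')
  simpa [levelState] using this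

theorem span_levelState_orthogonal (n : ℕ) :
    (Submodule.span ℂ (Set.range (levelState n)))ᗮ = ⊥ := by
  rw [Submodule.eq_bot_iff]
  intro ψ hψ
  rw [Submodule.mem_orthogonal] at hψ
  refine Subtype.ext (eq_zero_of_inner_stateL2_eq_zero fun k m => ?_)
  by_cases hk : k = n
  · subst hk
    exact hψ _ (Submodule.subset_span ⟨m, rfl⟩)
  · exact inner_stateL2_eq_zero_of_mem_level hk m ψ.2

/-- The angular momentum basis of the `n`-th Landau level. -/
noncomputable def levelBasis (n : ℕ) : HilbertBasis ℕ ℂ (level n) :=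
  HilbertBasis.mkOfOrthogonalEqBot (orthonormal_levelState n) (span_levelState_orthogonal n)

theorem coe_levelBasis (n : ℕ) : (levelBasis n : ℕ → level n) = levelState n :=
  HilbertBasis.coe_mkOfOrthogonalEqBot _ _

theorem dense_span_levelState (n : ℕ) :
    Dense (Submodule.span ℂ (Set.range (levelState n)) : Set (level n)) := by
  rw [Submodule.dense_iff_topologicalClosure_eq_top, ← coe_levelBasis]
  exact (levelBasis n).dense_span

/-- The unitary from the `n`-th to the lowest Landau level that preserves angular momentum states
of the guiding center. -/
noncomputable def ladderUnitary (n : ℕ) : level n ≃ₗᵢ[ℂ] level 0 :=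
  (levelBasis n).repr.trans (levelBasis 0).repr.symm

theorem ladderUnitary_levelState (n m : ℕ) :
    ladderUnitary n (levelState n m) = levelState 0 m := by
  rw [← coe_levelBasis, ← coe_levelBasis, ladderUnitary, LinearIsometryEquiv.trans_apply,
    HilbertBasis.repr_self, HilbertBasis.repr_symm_single]

theorem annihilation_pow_state (n m : ℕ) :
    (((Real.sqrt (n.factorial : ℝ))⁻¹ : ℝ) : ℂ) • (annihilation ^ n) (toDist (stateL2 (n, m))) =
      toDist (stateL2 (0, m)) := by
  rw [stateL2, annihilation_pow_toDist, ← map_smul, ← toLp_smul, state, map_smul, rawState,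
    lower_pow_raise_pow comm_cyclotron (lower_center_pow_ground m), Nat.sub_self,
    Nat.descFactorial_self, stateL2, state, rawState, ← sqrt_factorial_sq, smul_smul, smul_smul]
  congr 3
  have h1 := sqrt_factorial_ne_zero n
  have h2 := sqrt_factorial_ne_zero m
  push_cast
  simp
  field_simp

theorem isLadderUnitary_ladderUnitary (n : ℕ) : IsLadderUnitary n (ladderUnitary n) := by
  have h : toDist ∘L (level 0).subtypeL ∘L
      ((ladderUnitary n).toContinuousLinearEquiv : level n →L[ℂ] level 0) =
      ((((Real.sqrt (n.factorial : ℝ))⁻¹ : ℝ) : ℂ) • (annihilation ^ n)) ∘L toDist ∘L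
        (level n).subtypeL := by
    -- Both sides are continuous from the level into tempered distributions, so the basis states
    -- suffice even though `aⁿ` is unbounded on `L²`.
    refine ContinuousLinearMap.ext_on (dense_span_levelState n) ?_
    rintro _ ⟨m, rfl⟩
    change toDist (ladderUnitary n (levelState n m) : L2Plane) = _
    rw [ladderUnitary_levelState]
    exact (annihilation_pow_state n m).symm
  intro ψ
  exact congrArg (fun L => L ψ) h

theorem IsLadderUnitary.unique {n : ℕ} {U V : level n ≃ₗᵢ[ℂ] level 0} (hU : IsLadderUnitary n U)
    (hV : IsLadderUnitary n V) : U = V := by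
  ext1 ψ
  exact Subtype.ext (toDist_injective ((hU ψ).trans (hV ψ).symm))

/-! ### Translations in phase space -/

theorem iteratedDeriv_cexp_I_mul (n : ℕ) :
    iteratedDeriv n (fun t : ℝ => Complex.exp (Complex.I * t)) =
      fun t : ℝ => Complex.I ^ n * Complex.exp (Complex.I * t) := by
  induction n with
  | zero => simp
  | succ n ih =>
    rw [iteratedDeriv_succ, ih]
    ext t
    have h : HasDerivAt (fun t : ℝ => Complex.I * (t : ℂ)) (Complex.I * 1) t :=
      (Complex.ofRealCLM.hasDerivAt (x := t)).const_mul Complex.I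
    rw [(h.cexp.const_mul (Complex.I ^ n)).deriv]
    ring

theorem wave_hasTemperateGrowth (p : Plane) : Function.HasTemperateGrowth
    (fun r : Plane => Complex.exp (Complex.I * ((inner ℝ p r : ℝ) : ℂ))) := by
  have h : Function.HasTemperateGrowth (fun t : ℝ => Complex.exp (Complex.I * t)) := by
    refine ⟨(contDiff_const.mul Complex.ofRealCLM.contDiff).cexp, fun n => ⟨0, 1, fun t => ?_⟩⟩
    rw [norm_iteratedFDeriv_eq_norm_iteratedDeriv, iteratedDeriv_cexp_I_mul, norm_mul, norm_pow,
      Complex.norm_I, mul_comm Complex.I, Complex.norm_exp_ofReal_mul_I]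
    simp
  exact h.comp (Function.hasTemperateGrowth_inner_right p)

/-- The translation `f ↦ e^{i p · r} f(r + v)` in phase space of Schwartz functions. -/
noncomputable def testShift (p v : Plane) : Module.End ℂ Test :=
  (SchwartzMap.smulLeftCLM ℂ (fun r : Plane => Complex.exp (Complex.I * ((inner ℝ p r : ℝ) : ℂ))) ∘L
    SchwartzMap.compSubConstCLM ℂ (-v)).toLinearMap

theorem testShift_apply (p v : Plane) (f : Test) (r : Plane) :
    testShift p v f r = Complex.exp (Complex.I * ((inner ℝ p r : ℝ) : ℂ)) * f (r + v) := by
  change SchwartzMap.smulLeftCLM ℂ (fun r : Plane => Complex.exp (Complex.I * ((inner ℝ p r : ℝ) : ℂ)))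
    (SchwartzMap.compSubConstCLM ℂ (-v) f) r = _
  rw [SchwartzMap.smulLeftCLM_apply_apply (wave_hasTemperateGrowth p),
    SchwartzMap.compSubConstCLM_apply, sub_neg_eq_add, smul_eq_mul]

theorem norm_testShift_apply (p v : Plane) (f : Test) (r : Plane) :
    ‖testShift p v f r‖ = ‖f (r + v)‖ := by
  rw [testShift_apply, norm_mul, mul_comm Complex.I, Complex.norm_exp_ofReal_mul_I, one_mul]

/-- The translation of functions by `v`, as an isometry of `L²(ℝ²)`. -/
noncomputable def translate (v : Plane) : L2Plane →ₗᵢ[ℂ] L2Plane :=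
  Lp.compMeasurePreservingₗᵢ ℂ (fun r => r + v)
    (measurePreserving_add_right (volume : Measure Plane) v)

/-- The translation `ψ ↦ e^{i p · r} ψ(r + v)` in phase space. -/
noncomputable def shift (p v : Plane) : L2Plane →L[ℂ] L2Plane :=
  planeWave p ∘L (translate v).toContinuousLinearMap

theorem shift_apply (p v : Plane) (ψ : L2Plane) : shift p v ψ =ᵐ[volume]
    fun r => Complex.exp (Complex.I * ((inner ℝ p r : ℝ) : ℂ)) * ψ (r + v) := by
  have h1 := planeWave_apply p (translate v ψ)
  have h2 := Lp.coeFn_compMeasurePreserving ψ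
    (measurePreserving_add_right (volume : Measure Plane) v)
  filter_upwards [h1, h2] with r hr1 hr2
  refine hr1.trans ?_
  congr 1

theorem norm_planeWave (p : Plane) (ψ : L2Plane) : ‖planeWave p ψ‖ = ‖ψ‖ := by
  rw [Lp.norm_def, Lp.norm_def]
  congr 1
  refine eLpNorm_congr_norm_ae ?_
  filter_upwards [planeWave_apply p ψ] with r hr
  rw [hr, norm_mul, mul_comm Complex.I, Complex.norm_exp_ofReal_mul_I, one_mul]

theorem norm_shift (p v : Plane) (ψ : L2Plane) : ‖shift p v ψ‖ = ‖ψ‖ :=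
  (norm_planeWave p _).trans ((translate v).norm_map ψ)

theorem shift_toLp (p v : Plane) (f : Test) : shift p v (f.toLp 2) = (testShift p v f).toLp 2 := by
  refine Lp.ext ?_
  have h : (fun r => f.toLp 2 (volume : Measure Plane) (r + v)) =ᵐ[volume] fun r => f (r + v) :=
    (measurePreserving_add_right (volume : Measure Plane) v).quasiMeasurePreserving.ae_eq_comp
      (f.coeFn_toLp 2 (volume : Measure Plane))
  filter_upwards [shift_apply p v (f.toLp 2), h,
    (testShift p v f).coeFn_toLp 2 (volume : Measure Plane)] with r h1 h2 h3
  rw [h1, h2, h3, testShift_apply]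

theorem planeWave_toLp (p : Plane) (f : Test) :
    planeWave p (f.toLp 2) = (testShift p 0 f).toLp 2 := by
  rw [← shift_toLp]
  refine Lp.ext ?_
  filter_upwards [planeWave_apply p (f.toLp 2), shift_apply p 0 (f.toLp 2)] with r h1 h2
  rw [h1, h2, add_zero]

theorem denseRange_toLp : DenseRange fun f : Test => f.toLp 2 (volume : Measure Plane) :=
  SchwartzMap.denseRange_toLpCLM (F := ℂ) (p := 2) (by norm_num)

theorem clm_ext_toLp {P Q : L2Plane →L[ℂ] L2Plane}
    (h : ∀ f : Test, P (f.toLp 2) = Q (f.toLp 2)) : P = Q := by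
  have := denseRange_toLp.equalizer P.continuous Q.continuous (funext h)
  exact ContinuousLinearMap.ext fun ψ => congrFun this ψ

theorem shift_zero : shift 0 0 = ContinuousLinearMap.id ℂ L2Plane := by
  refine clm_ext_toLp fun f => ?_
  rw [shift_toLp]
  change _ = f.toLp 2
  congr 1
  ext r
  simp [testShift_apply]

/-- Composition produces the cocycle phase `e^{i s t p·v}`, which is trivial when `p ⊥ v`. -/
theorem testShift_add {p v : Plane} (hpv : inner ℝ p v = 0) (s t : ℝ) (f : Test) :
    testShift ((s + t) • p) ((s + t) • v) f =
      testShift (s • p) (s • v) (testShift (t • p) (t • v) f) := by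
  ext r
  simp only [testShift_apply, ← mul_assoc, ← Complex.exp_add, inner_add_left, inner_add_right,
    real_inner_smul_left, real_inner_smul_right, hpv, add_smul, add_assoc]
  push_cast
  ring_nf

theorem shift_add {p v : Plane} (hpv : inner ℝ p v = 0) (s t : ℝ) :
    shift ((s + t) • p) ((s + t) • v) = shift (s • p) (s • v) ∘L shift (t • p) (t • v) := by
  refine clm_ext_toLp fun f => ?_
  rw [ContinuousLinearMap.comp_apply, shift_toLp, shift_toLp, shift_toLp, testShift_add hpv]

theorem toDist_shift {p v : Plane} (hpv : inner ℝ p v = 0) (ψ : L2Plane) (f : Test) :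
    toDist (shift p v ψ) f = toDist ψ (testShift p (-v) f) := by
  rw [toDist_apply, toDist_apply, ← integral_add_right_eq_self (fun r => testShift p (-v) f r * ψ r) v]
  refine integral_congr_ae ?_
  filter_upwards [shift_apply p v ψ] with r hr
  rw [hr, testShift_apply, inner_add_right, hpv, add_zero, add_neg_cancel_right]
  ring

/-- The generator `i p · r + v · ∇` of translations in phase space. -/
noncomputable def testGen (p v : Plane) : Module.End ℂ Test :=
  Complex.I • testDot p + (((v 0 : ℝ) : ℂ) • testD 0 + ((v 1 : ℝ) : ℂ) • testD 1)

theorem testGen_apply (p v : Plane) (f : Test) (r : Plane) :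
    testGen p v f r = Complex.I * ((inner ℝ p r : ℝ) : ℂ) * f r + fderiv ℝ f r v := by
  have hv : v = v 0 • EuclideanSpace.single 0 (1 : ℝ) + v 1 • EuclideanSpace.single 1 (1 : ℝ) := by
    ext j
    fin_cases j <;> simp
  conv_rhs => rw [hv, map_add, map_smul, map_smul, ← testD_apply, ← testD_apply]
  rw [testGen, LinearMap.add_apply, LinearMap.add_apply, LinearMap.smul_apply,
    LinearMap.smul_apply, LinearMap.smul_apply, add_apply, add_apply, smul_apply, smul_apply,
    smul_apply, testDot_apply]
  simp only [smul_eq_mul, Complex.real_smul]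
  ring

theorem hasDerivAt_testShift_apply {p v : Plane} (hpv : inner ℝ p v = 0) (f : Test) (r : Plane)
    (s : ℝ) : HasDerivAt (fun s : ℝ => testShift (s • p) (s • v) f r)
      (testShift (s • p) (s • v) (testGen p v f) r) s := by
  simp only [testShift_apply, testGen_apply, real_inner_smul_left]
  have h1 : HasDerivAt (fun s : ℝ => Complex.I * ((s * inner ℝ p r : ℝ) : ℂ))
      (Complex.I * ((1 * inner ℝ p r : ℝ) : ℂ)) s :=
    (((hasDerivAt_id s).mul_const (inner ℝ p r)).ofReal_comp).const_mul Complex.I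
  have h2 : HasDerivAt (fun s : ℝ => f (r + s • v)) (fderiv ℝ f (r + s • v) v) s := by
    have h3 : HasDerivAt (fun s : ℝ => r + s • v) v s := by
      simpa using ((hasDerivAt_id s).smul_const v).const_add r
    exact (f.hasFDerivAt (r + s • v)).comp_hasDerivAt s h3
  refine (h1.cexp.fun_mul h2).congr_deriv ?_
  rw [inner_add_right, real_inner_smul_right, hpv]
  push_cast
  ring

/-- A square integrable majorant, uniform for bounded times, for differentiating under the integral:
Schwartz decay combined with `1 + |r| ≤ (1 + R|v|)(1 + |r + s v|)`. -/
theorem exists_testShift_bound (v : Plane) (f : Test) (R : ℝ) : ∃ b : Plane → ℝ,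
    MemLp b 2 volume ∧ ∀ (p : Plane) (s : ℝ), |s| ≤ R → ∀ r, ‖testShift p (s • v) f r‖ ≤ b r := by
  obtain ⟨k, hk⟩ := (inferInstance :
    (volume : Measure Plane).HasTemperateGrowth).exists_eLpNorm_lt_top 2
  set C := 2 ^ k * (Finset.Iic (k, 0)).sup (fun m => SchwartzMap.seminorm ℂ m.1 m.2) f with hC
  have hf : ∀ r, (1 + ‖r‖) ^ k * ‖f r‖ ≤ C := fun r => by
    have := SchwartzMap.one_add_le_sup_seminorm_apply (𝕜 := ℂ) (m := (k, 0)) (k := k) (n := 0)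
      le_rfl le_rfl f r
    rwa [norm_iteratedFDeriv_zero] at this
  have hb : MemLp (fun r : Plane => (1 + ‖r‖) ^ (-k : ℝ)) 2 volume := by
    refine ⟨?_, hk⟩
    have : Continuous fun r : Plane => (1 + ‖r‖) ^ (-k : ℝ) :=
      (continuous_const.add continuous_norm).rpow_const fun r => Or.inl (add_pos_of_pos_of_nonneg one_pos (norm_nonneg r)).ne'
    exact this.aestronglyMeasurable
  refine ⟨fun r => (C * (1 + R * ‖v‖) ^ k) * (1 + ‖r‖) ^ (-k : ℝ), hb.const_mul _, ?_⟩
  intro p s hs r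
  have h1 : 1 + ‖r‖ ≤ (1 + R * ‖v‖) * (1 + ‖r + s • v‖) := by
    have h2 : ‖r‖ ≤ ‖r + s • v‖ + R * ‖v‖ := by
      calc ‖r‖ = ‖(r + s • v) - s • v‖ := by rw [add_sub_cancel_right]
        _ ≤ ‖r + s • v‖ + ‖s • v‖ := norm_sub_le _ _
        _ ≤ _ := by rw [norm_smul, Real.norm_eq_abs]; gcongr
    have h3 : 0 ≤ R * ‖v‖ := mul_nonneg ((abs_nonneg s).trans hs) (norm_nonneg v)
    nlinarith [norm_nonneg (r + s • v), mul_nonneg h3 (norm_nonneg (r + s • v))]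
  have hR : 0 ≤ 1 + R * ‖v‖ :=
    add_nonneg zero_le_one (mul_nonneg ((abs_nonneg s).trans hs) (norm_nonneg v))
  beta_reduce
  rw [norm_testShift_apply, Real.rpow_neg (by positivity), Real.rpow_natCast, ← div_eq_mul_inv,
    le_div_iff₀ (by positivity)]
  calc ‖f (r + s • v)‖ * (1 + ‖r‖) ^ k
      ≤ ‖f (r + s • v)‖ * ((1 + R * ‖v‖) * (1 + ‖r + s • v‖)) ^ k := by gcongr
    _ = ((1 + ‖r + s • v‖) ^ k * ‖f (r + s • v)‖) * (1 + R * ‖v‖) ^ k := by rw [mul_pow]; ring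
    _ ≤ _ := by
      gcongr
      exact hf _

theorem hasDerivAt_toDist_testShift {p v : Plane} (hpv : inner ℝ p v = 0) (ψ : L2Plane) (f : Test)
    (s : ℝ) : HasDerivAt (fun s : ℝ => toDist ψ (testShift (s • p) (s • v) f))
      (toDist ψ (testShift (s • p) (s • v) (testGen p v f))) s := by
  -- The radius `|s| + 1` covers the unit ball around `s`.
  obtain ⟨b, hb, hbound⟩ := exists_testShift_bound v (testGen p v f) (|s| + 1)
  simp only [toDist_apply]
  refine (hasDerivAt_integral_of_dominated_loc_of_deriv_le (Metric.ball_mem_nhds s one_pos)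
    (Filter.Eventually.of_forall fun t => (integrable_test_mul _ ψ).aestronglyMeasurable)
    (integrable_test_mul _ ψ)
    (F' := fun t r => testShift (t • p) (t • v) (testGen p v f) r * ψ r)
    (bound := fun r => b r * ‖ψ r‖)
    (integrable_test_mul _ ψ).aestronglyMeasurable ?_ (hb.integrable_mul (Lp.memLp ψ).norm) ?_).2
  · refine Filter.Eventually.of_forall fun r t ht => ?_
    rw [norm_mul]
    refine mul_le_mul_of_nonneg_right (hbound _ t ?_ r) (norm_nonneg _)
    have h1 : |t - s| < 1 := by simpa [Real.dist_eq] using ht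
    have h2 := abs_sub_abs_le_abs_sub t s
    linarith
  · exact Filter.Eventually.of_forall fun r t _ =>
      (hasDerivAt_testShift_apply hpv f r t).mul_const (ψ r)

theorem testConj_testConj (f : Test) : testConj (testConj f) = f := by
  ext r
  simp [testConj_apply]

theorem toDist_eq_inner (ψ : L2Plane) (f : Test) :
    toDist ψ f = innerSL ℂ ((testConj f).toLp 2 (volume : Measure Plane)) ψ := by
  rw [innerSL_apply_apply, inner_toLp, testConj_testConj]

theorem hasDerivAt_toDist_apply {u : ℝ → L2Plane} {u' : L2Plane} {t : ℝ} (h : HasDerivAt u u' t)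
    (f : Test) : HasDerivAt (fun t => toDist (u t) f) (toDist u' f) t := by
  simp only [toDist_eq_inner]
  exact ((innerSL ℂ ((testConj f).toLp 2 (volume : Measure Plane))).restrictScalars
    ℝ).hasFDerivAt.comp_hasDerivAt t h

open Filter Topology in
-- Expanding `|u - x|²`: for constant norms, convergence of the pairing with the limit forces norm
-- convergence.
theorem tendsto_of_tendsto_inner_of_norm_eq {X H : Type*} [NormedAddCommGroup H]
    [InnerProductSpace ℂ H] {l : Filter X} {u : X → H} {x : H} (hn : ∀ t, ‖u t‖ = ‖x‖)
    (h : Tendsto (fun t => inner ℂ x (u t)) l (𝓝 (inner ℂ x x))) : Tendsto u l (𝓝 x) := by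
  have h2 : ∀ t, ‖u t - x‖ ^ 2 = 2 * ‖x‖ ^ 2 - 2 * (inner ℂ x (u t)).re := by
    intro t
    have h := norm_sub_sq (𝕜 := ℂ) x (u t)
    rw [hn, RCLike.re_eq_complex_re] at h
    rw [norm_sub_rev, h]
    ring
  have h3 : Tendsto (fun t => ‖u t - x‖ ^ 2) l (𝓝 0) := by
    simp only [h2]
    have h5 := (((Complex.continuous_re.tendsto _).comp h).const_mul 2).const_sub (2 * ‖x‖ ^ 2)
    have h6 : (inner ℂ x x).re = ‖x‖ ^ 2 := inner_self_eq_norm_sq (𝕜 := ℂ) x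
    rw [h6, sub_self] at h5
    exact h5
  rw [tendsto_iff_norm_sub_tendsto_zero]
  simpa only [Real.sqrt_sq (norm_nonneg _), Real.sqrt_zero] using h3.sqrt

/-! ### The one-parameter group of translations and its generator -/

section Shift

variable {p v : Plane}

theorem toDist_shift_smul (hpv : inner ℝ p v = 0) (t : ℝ) (ψ : L2Plane) (f : Test) :
    toDist (shift (t • p) (t • v) ψ) f = toDist ψ (testShift (t • p) (t • (-v)) f) := by
  rw [toDist_shift (by rw [real_inner_smul_left, real_inner_smul_right, hpv]; simp), smul_neg]

theorem inner_neg_eq_zero (hpv : inner ℝ p v = 0) : inner ℝ p (-v) = 0 := by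
  rw [inner_neg_right, hpv, neg_zero]

theorem testShift_zero (f : Test) : testShift 0 0 f = f := by
  ext r
  simp [testShift_apply]

/-- Both sides are the derivative at `0` of `s ↦` the translation by `s + t`, factored in the two
possible orders. -/
theorem testShift_testGen (hpv : inner ℝ p v = 0) (t : ℝ) (f : Test) :
    testShift (t • p) (t • v) (testGen p v f) = testGen p v (testShift (t • p) (t • v) f) := by
  ext r
  have h1 := hasDerivAt_testShift_apply hpv (testShift (t • p) (t • v) f) r 0
  simp only [← testShift_add hpv, zero_smul, testShift_zero] at h1
  have h2 : HasDerivAt (fun s : ℝ => testShift ((s + t) • p) ((s + t) • v) f r)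
      (testShift ((0 + t) • p) ((0 + t) • v) (testGen p v f) r) 0 :=
    (hasDerivAt_testShift_apply hpv f r (0 + t)).comp_add_const 0 t
  rw [zero_add] at h2
  exact h2.unique h1

theorem hasDerivAt_toDist_shift (hpv : inner ℝ p v = 0) (ψ : L2Plane) (f : Test) (t : ℝ) :
    HasDerivAt (fun t : ℝ => toDist (shift (t • p) (t • v) ψ) f)
      (toDist ψ (testGen p (-v) (testShift (t • p) (t • (-v)) f))) t := by
  simp only [toDist_shift_smul hpv]
  rw [← testShift_testGen (inner_neg_eq_zero hpv)]
  exact hasDerivAt_toDist_testShift (inner_neg_eq_zero hpv) ψ f t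

theorem tendsto_shift_toLp (hpv : inner ℝ p v = 0) (f : Test) :
    Filter.Tendsto (fun t : ℝ => shift (t • p) (t • v) (f.toLp 2)) (nhds 0) (nhds (f.toLp 2)) := by
  refine tendsto_of_tendsto_inner_of_norm_eq (fun t => norm_shift _ _ _) ?_
  have := (hasDerivAt_toDist_shift hpv (f.toLp 2) (testConj f) 0).continuousAt.tendsto
  simpa only [inner_toLp, zero_smul, shift_zero, ContinuousLinearMap.id_apply] using this

open Filter Topology in
theorem tendsto_shift (hpv : inner ℝ p v = 0) (ψ : L2Plane) :
    Tendsto (fun t : ℝ => shift (t • p) (t • v) ψ) (𝓝 0) (𝓝 ψ) := by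
  rw [Metric.tendsto_nhds]
  intro ε hε
  obtain ⟨f, hf⟩ := Metric.denseRange_iff.mp denseRange_toLp ψ (ε / 3) (by positivity)
  filter_upwards [Metric.tendsto_nhds.mp (tendsto_shift_toLp hpv f) (ε / 3) (by positivity)] with t ht
  have h1 : dist (shift (t • p) (t • v) ψ) (shift (t • p) (t • v) (f.toLp 2)) < ε / 3 := by
    rwa [dist_eq_norm, ← map_sub, norm_shift, ← dist_eq_norm]
  have h2 : dist (f.toLp 2) ψ < ε / 3 := by rwa [dist_comm]
  calc _ ≤ _ := dist_triangle4 _ (shift (t • p) (t • v) (f.toLp 2)) (f.toLp 2) _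
    _ < ε := by linarith

theorem continuous_shift (hpv : inner ℝ p v = 0) (ψ : L2Plane) :
    Continuous fun t : ℝ => shift (t • p) (t • v) ψ := by
  rw [continuous_iff_continuousAt]
  intro t
  have h1 : ∀ s : ℝ, shift (s • p) (s • v) ψ =
      shift ((s - t) • p) ((s - t) • v) (shift (t • p) (t • v) ψ) := fun s => by
    rw [← ContinuousLinearMap.comp_apply, ← shift_add hpv, sub_add_cancel]
  have h2 : Filter.Tendsto (fun s : ℝ => s - t) (nhds t) (nhds 0) := by
    have : Continuous fun s : ℝ => s - t := by fun_prop
    simpa using this.tendsto t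
  unfold ContinuousAt
  refine ((tendsto_shift hpv (shift (t • p) (t • v) ψ)).comp h2).congr fun s => ?_
  exact (h1 s).symm

/-- From weak to strong differentiability: the orbit of `ψ` and `ψ + ∫ i·(orbit of φ)` have the same
pairings with Schwartz functions, hence coincide, and the integral of a continuous curve is norm
differentiable. -/
theorem hasDerivAt_shift (hpv : inner ℝ p v = 0) {ψ φ : L2Plane}
    (h : ∀ f : Test, Complex.I * toDist φ f = toDist ψ (testGen p (-v) f)) :
    HasDerivAt (fun t : ℝ => shift (t • p) (t • v) ψ) (Complex.I • φ) 0 := by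
  set F : ℝ → L2Plane := fun t => ψ + ∫ s in (0 : ℝ)..t, Complex.I • shift (s • p) (s • v) φ with hF
  have hc : Continuous fun s : ℝ => Complex.I • shift (s • p) (s • v) φ :=
    (continuous_shift hpv φ).const_smul Complex.I
  have hF' : ∀ t, HasDerivAt F (Complex.I • shift (t • p) (t • v) φ) t := fun t =>
    (hc.integral_hasStrictDerivAt 0 t).hasDerivAt.const_add ψ
  have hV : ∀ t, shift (t • p) (t • v) ψ = F t := by
    intro t
    refine toDist_injective ?_
    ext f
    have hd : ∀ t, HasDerivAt (fun t : ℝ => toDist (shift (t • p) (t • v) ψ) f - toDist (F t) f)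
        0 t := by
      intro t
      have h1 := (hasDerivAt_toDist_shift hpv ψ f t).sub (hasDerivAt_toDist_apply (hF' t) f)
      rw [← h, toDist_smul_apply, toDist_shift_smul hpv, sub_self] at h1
      exact h1
    have h2 := is_const_of_deriv_eq_zero (fun t => (hd t).differentiableAt) (fun t => (hd t).deriv) t 0
    simp only [zero_smul, shift_zero, hF, intervalIntegral.integral_same, add_zero,
      ContinuousLinearMap.id_apply, sub_self] at h2
    exact sub_eq_zero.mp h2
  have h3 := hF' 0
  rw [zero_smul, zero_smul, shift_zero] at h3
  rw [funext hV]
  exact h3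

theorem isExpGroup_shift (hpv : inner ℝ p v = 0) {A : DistOp}
    (hA : ∀ T f, Complex.I * A T f = T (testGen p (-v) f)) :
    IsExpGroup A fun t => shift (t • p) (t • v) where
  zero := by rw [zero_smul, zero_smul, shift_zero]
  add := shift_add hpv
  isometry t := norm_shift _ _
  continuous := continuous_shift hpv
  generator ψ φ := by
    constructor
    · intro h
      ext f
      have h1 := (hasDerivAt_toDist_apply h f).unique (hasDerivAt_toDist_shift hpv ψ f 0)
      rw [zero_smul, zero_smul, testShift_zero, ← hA, toDist_smul_apply] at h1
      exact mul_left_cancel₀ Complex.I_ne_zero h1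
    · intro h
      refine hasDerivAt_shift hpv fun f => ?_
      rw [h, hA]

end Shift

/-! ### Uniqueness of the group with a given generator -/

namespace IsExpGroup

variable {A : DistOp} {W W' : ℝ → L2Plane →L[ℂ] L2Plane}

theorem hasDerivAt (hW : IsExpGroup A W) {ψ φ : L2Plane} (h : toDist φ = A (toDist ψ)) (t : ℝ) :
    HasDerivAt (fun t => W t ψ) (Complex.I • W t φ) t := by
  have h1 : HasDerivAt (fun s => W t (W s ψ)) (W t (Complex.I • φ)) 0 :=
    ((W t).restrictScalars ℝ).hasFDerivAt.comp_hasDerivAt 0 ((hW.generator ψ φ).mpr h)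
  have h2 : (fun s => W t (W s ψ)) = fun s => W (t + s) ψ := by
    ext1 s
    rw [hW.add]
    rfl
  rw [h2, map_smul] at h1
  have h3 : HasDerivAt (fun s => W (t + s) ψ) (Complex.I • W t φ) (t - t) := by rwa [sub_self]
  have h4 := h3.comp_sub_const t t
  simpa using h4

/-- The group preserves the domain of its generator and commutes with it there. -/
theorem toDist_apply_eq (hW : IsExpGroup A W) {ψ φ : L2Plane} (h : toDist φ = A (toDist ψ))
    (t : ℝ) : toDist (W t φ) = A (toDist (W t ψ)) := by
  rw [← hW.generator]
  have h1 : HasDerivAt (fun s => W s ψ) (Complex.I • W t φ) (0 + t) := by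
    rw [zero_add]
    exact hW.hasDerivAt h t
  refine (h1.comp_add_const 0 t).congr_of_eventuallyEq (Filter.Eventually.of_forall fun s => ?_)
  simp only [hW.add]
  rfl

/-- Symmetry of the generator, obtained by differentiating the constant norm along the orbit. -/
theorem inner_generator (hW : IsExpGroup A W) {ψ φ : L2Plane} (h : toDist φ = A (toDist ψ)) :
    inner ℂ ψ (Complex.I • φ) + inner ℂ (Complex.I • φ) ψ = 0 := by
  have h1 := (hW.generator ψ φ).mpr h
  have h2 := h1.inner ℂ h1
  have h3 : (fun t => inner ℂ (W t ψ) (W t ψ)) = fun _ => ((‖ψ‖ : ℂ)) ^ 2 := by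
    ext1 t
    rw [inner_self_eq_norm_sq_to_K, hW.isometry]
    rfl
  rw [h3, hW.zero] at h2
  exact h2.unique (hasDerivAt_const _ _)

/-- For a Schwartz initial vector the difference `d` of the two orbits stays in the domain and
satisfies `d' = iAd`; symmetry of `A` makes its norm constant, and it starts at `0`. Density of
Schwartz functions concludes. -/
theorem unique (hW : IsExpGroup A W) (hW' : IsExpGroup A W')
    (hA : ∀ f : Test, ∃ φ : L2Plane, toDist φ = A (toDist (f.toLp 2))) : W = W' := by
  ext1 t
  refine clm_ext_toLp fun f => ?_
  obtain ⟨φ, hφ⟩ := hA f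
  set d : ℝ → L2Plane := fun t => W t (f.toLp 2) - W' t (f.toLp 2) with hd
  have h1 : ∀ t, HasDerivAt d (Complex.I • (W t φ - W' t φ)) t := fun t => by
    rw [smul_sub]
    exact (hW.hasDerivAt hφ t).sub (hW'.hasDerivAt hφ t)
  have h2 : ∀ t, toDist (W t φ - W' t φ) = A (toDist (d t)) := fun t => by
    rw [map_sub, hW.toDist_apply_eq hφ, hW'.toDist_apply_eq hφ, ← map_sub, ← map_sub]
  have h3 : ∀ t, HasDerivAt (fun t => inner ℂ (d t) (d t)) 0 t := fun t => by
    have := (h1 t).inner ℂ (h1 t)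
    rwa [hW.inner_generator (h2 t)] at this
  have h4 := is_const_of_deriv_eq_zero (fun t => (h3 t).differentiableAt) (fun t => (h3 t).deriv) t 0
  have h5 : d 0 = 0 := by simp only [hd, hW.zero, hW'.zero, sub_self]
  rw [h5, inner_zero_left, inner_self_eq_zero] at h4
  exact sub_eq_zero.mp h4

end IsExpGroup

/-! ### Displacement of the ladder operators; magnetic translations -/

/-- The amount by which the operator `ladder σ τ` is displaced by the translation by `(p, v)` in
phase space. -/
noncomputable def displacement (σ τ : ℝ) (p v : Plane) : ℂ :=
  (1 / 2 : ℂ) * (-((v 0 : ℂ) + Complex.I * σ * v 1) +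
    τ * (Complex.I * p 0 + Complex.I * σ * (Complex.I * p 1)))

theorem testPos_testShift (j : Fin 2) (p v : Plane) (f : Test) :
    testPos j (testShift p v f) = testShift p v (testPos j f) - ((v j : ℝ) : ℂ) • testShift p v f := by
  ext r
  rw [sub_apply, smul_apply, testPos_apply, testShift_apply, testShift_apply, testPos_apply,
    PiLp.add_apply, smul_eq_mul]
  push_cast
  ring

theorem testD_testShift (j : Fin 2) (p v : Plane) (f : Test) :
    testD j (testShift p v f) =
      testShift p v (testD j f) + (Complex.I * ((p j : ℝ) : ℂ)) • testShift p v f := by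
  ext r
  have h1 : HasFDerivAt (fun r : Plane => Complex.I * ((inner ℝ p r : ℝ) : ℂ))
      (Complex.I • (Complex.ofRealCLM ∘L innerSL ℝ p)) r :=
    (Complex.ofRealCLM ∘L innerSL ℝ p).hasFDerivAt.const_mul Complex.I
  have h2 : HasFDerivAt (fun r : Plane => f (r + v)) (fderiv ℝ f (r + v)) r :=
    (f.hasFDerivAt (r + v)).comp r ((hasFDerivAt_id r).add_const v)
  have h3 : (testShift p v f : Plane → ℂ) = fun r =>
      Complex.exp (Complex.I * ((inner ℝ p r : ℝ) : ℂ)) * f (r + v) := funext (testShift_apply p v f)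
  rw [testD_apply, h3, (h1.cexp.fun_mul h2).fderiv, add_apply, add_apply,
    testShift_apply, testD_apply]
  simp [testShift_apply, EuclideanSpace.inner_single_right]
  ring

theorem ladder_testShift (σ τ : ℝ) (p v : Plane) (f : Test) : ladder σ τ (testShift p v f) =
    testShift p v (ladder σ τ f) + displacement σ τ p v • testShift p v f := by
  simp only [ladder, LinearMap.smul_apply, LinearMap.add_apply, testPos_testShift, testD_testShift,
    map_add, map_smul, displacement]
  module

/-- The complex number `(i q_x - q_y) / 2` by which the plane wave `e^{i q · r}` displaces the
annihilation operator. -/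
noncomputable def waveDisplacement (q : Plane) : ℂ := (1 / 2 : ℂ) * (Complex.I * q 0 - q 1)

theorem conj_waveDisplacement (q : Plane) :
    starRingEnd ℂ (waveDisplacement q) = (1 / 2 : ℂ) * (-(Complex.I * q 0) - q 1) := by
  simp [waveDisplacement, map_ofNat (starRingEnd ℂ) 2]

theorem normSq_waveDisplacement (q : Plane) :
    Complex.normSq (waveDisplacement q) = ‖q‖ ^ 2 / 4 := by
  have h : waveDisplacement q = ⟨-(q 1) / 2, q 0 / 2⟩ := by
    apply Complex.ext <;> simp [waveDisplacement] <;> ring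
  rw [h, Complex.normSq_mk, EuclideanSpace.norm_sq_eq, Fin.sum_univ_two]
  simp only [Real.norm_eq_abs, sq_abs]
  ring

/-- The vector `(-q_y, q_x) / 2` by which the magnetic translation `e^{i q · R}` translates. -/
noncomputable def drift (q : Plane) : Plane := !₂[-(q 1) / 2, q 0 / 2]

theorem drift_zero (q : Plane) : drift q 0 = -(q 1) / 2 := rfl

theorem drift_one (q : Plane) : drift q 1 = q 0 / 2 := rfl

theorem inner_drift (q : Plane) : inner ℝ q (drift q) = 0 := by
  simp only [PiLp.inner_apply, Fin.sum_univ_two, drift_zero, drift_one]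
  simp
  ring

theorem inner_half_drift (q : Plane) : inner ℝ ((1 / 2 : ℝ) • q) (drift q) = 0 := by
  rw [real_inner_smul_left, inner_drift, mul_zero]

/-- `i q·R = i (q/2)·r + drift q · ∇`; the minus sign before `drift q` comes from transposing the
derivative. -/
theorem I_mul_dotGuiding (q : Plane) (T : 𝓢'(Plane, ℂ)) (f : Test) :
    Complex.I * dotGuiding q T f = T (testGen ((1 / 2 : ℝ) • q) (-drift q) f) := by
  rw [dotGuiding_apply_apply, ← smul_eq_mul, ← map_smul]
  congr 1
  simp only [testGuiding, testGen, testDot, LinearMap.smul_apply, LinearMap.add_apply,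
    LinearMap.sub_apply, PiLp.smul_apply, PiLp.neg_apply, drift_zero, drift_one, smul_eq_mul]
  push_cast
  match_scalars <;> (ring_nf; try (simp only [Complex.I_sq]; ring))

/-- The magnetic translation group `t ↦ e^{i t q · R}`. -/
noncomputable def magneticTranslation (q : Plane) (t : ℝ) : L2Plane →L[ℂ] L2Plane :=
  shift (t • ((1 / 2 : ℝ) • q)) (t • drift q)

theorem isExpGroup_magneticTranslation (q : Plane) :
    IsExpGroup (dotGuiding q) (magneticTranslation q) :=
  isExpGroup_shift (inner_half_drift q) (I_mul_dotGuiding q)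

theorem exists_toDist_eq_dotGuiding (q : Plane) (f : Test) :
    ∃ φ : L2Plane, toDist φ = dotGuiding q (toDist (f.toLp 2)) := by
  refine ⟨((1 / 2 : ℂ) • (((q 0 : ℝ) : ℂ) • (testPos 0 f + (-Complex.I) • testD 1 f) +
    ((q 1 : ℝ) : ℂ) • (testPos 1 f + Complex.I • testD 0 f))).toLp 2, ?_⟩
  ext g
  rw [dotGuiding_apply_apply]
  simp only [toLp_add, toLp_smul, toDist_add_apply, toDist_smul_apply, toDist_toLp_testPos,
    toDist_toLp_testD]
  simp only [testGuiding, LinearMap.smul_apply, LinearMap.add_apply, LinearMap.sub_apply,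
    map_add, map_sub, map_smul, smul_eq_mul]
  ring

theorem IsExpGroup.eq_magneticTranslation {q : Plane} {W : ℝ → L2Plane →L[ℂ] L2Plane}
    (hW : IsExpGroup (dotGuiding q) W) : W = magneticTranslation q :=
  hW.unique (isExpGroup_magneticTranslation q) (exists_toDist_eq_dotGuiding q)

/-! ### Factoring the plane wave in the lowest Landau level -/

theorem testForm_eq_toDist (f g : Test) : testForm f g = toDist ((testConj f).toLp 2) g := by
  rw [testForm_apply, inner_toLp, toDist_toLp_apply, toDist_toLp_apply]
  congr 1 with r
  ring

theorem testForm_testShift_testShift (p v : Plane) (f g : Test) :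
    testForm (testShift p v f) (testShift p v g) = testForm f g := by
  rw [testForm_apply, testForm_apply, ← shift_toLp, ← shift_toLp]
  exact LinearIsometry.inner_map_map
    (⟨(shift p v).toLinearMap, norm_shift p v⟩ : L2Plane →ₗᵢ[ℂ] L2Plane) _ _

theorem testGen_half_neg_drift (q : Plane) (f : Test) :
    testGen ((1 / 2 : ℝ) • q) (-drift q) f = waveDisplacement q • ladder (-1) (-1) f -
      starRingEnd ℂ (waveDisplacement q) • ladder 1 1 f := by
  rw [conj_waveDisplacement]
  simp only [waveDisplacement, testGen, testDot, ladder,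
    LinearMap.smul_apply, LinearMap.add_apply, PiLp.smul_apply, PiLp.neg_apply, drift_zero,
    drift_one, smul_eq_mul]
  push_cast
  match_scalars <;> (ring_nf; try (simp only [Complex.I_sq]; ring))

theorem displacement_half_neg_drift (q : Plane) (t : ℝ) :
    displacement 1 1 (t • ((1 / 2 : ℝ) • q)) (t • (-drift q)) = t * waveDisplacement q := by
  simp only [displacement, waveDisplacement, PiLp.smul_apply, PiLp.neg_apply, drift_zero,
    drift_one, smul_eq_mul]
  push_cast
  ring_nf
  simp only [Complex.I_sq]
  ring

theorem displacement_half_drift (q : Plane) (t : ℝ) :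
    displacement 1 1 (t • ((1 / 2 : ℝ) • q)) (t • drift q) = 0 := by
  simp only [displacement, PiLp.smul_apply, drift_zero, drift_one, smul_eq_mul]
  push_cast
  ring_nf
  simp only [Complex.I_sq]
  ring

/-- The Debye-Waller factor: the cyclotron part of a plane wave has the vacuum expectation value
`exp (-|q|² / 8)`. -/
theorem testForm_cyclotron_shift (q : Plane) {f h : Test} (hf : ladder 1 1 f = 0)
    (hh : ladder 1 1 h = 0) : testForm f (testShift ((1 / 2 : ℝ) • q) (-drift q) h) =
      ((Real.exp (-(‖q‖ ^ 2 / 8)) : ℝ) : ℂ) * testForm f h := by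
  have hpv := inner_neg_eq_zero (inner_half_drift q)
  set V : ℝ → Test := fun t => testShift (t • ((1 / 2 : ℝ) • q)) (t • (-drift q)) h with hV
  -- `V' = c a† V - c̄ a V`: the first term pairs to zero because `a f = 0`, and `a V = t c V`
  -- because `a h = 0`, leaving the rate `-|c|² t`.
  have h1 : ∀ t : ℝ, HasDerivAt (fun t => testForm f (V t))
      (-(((‖q‖ ^ 2 / 4 * t : ℝ) : ℂ) * testForm f (V t))) t := by
    intro t
    have h2 := hasDerivAt_toDist_testShift hpv ((testConj f).toLp 2) h t
    simp only [← testForm_eq_toDist] at h2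
    rw [testShift_testGen hpv, testGen_half_neg_drift, map_sub, map_smul, map_smul,
      ladder_testShift 1 1, hh, map_zero, zero_add, displacement_half_neg_drift] at h2
    refine h2.congr_deriv ?_
    have h3 := testForm_ladder 1 1 f (V t)
    rw [hf, map_zero, LinearMap.zero_apply] at h3
    rw [← h3, map_smul, smul_zero, zero_sub, smul_smul, smul_eq_mul, ← normSq_waveDisplacement]
    push_cast
    rw [← Complex.mul_conj]
    ring
  -- The integrating factor `exp (|c|² t²/2)` makes the matrix element constant; comparing `t = 1`
  -- with `t = 0` gives the result.
  have h4 : ∀ t : ℝ, HasDerivAt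
      (fun t : ℝ => ((Real.exp (‖q‖ ^ 2 / 8 * t ^ 2) : ℝ) : ℂ) * testForm f (V t)) 0 t := by
    intro t
    have h5 : HasDerivAt (fun t : ℝ => Real.exp (‖q‖ ^ 2 / 8 * t ^ 2))
        (Real.exp (‖q‖ ^ 2 / 8 * t ^ 2) * (‖q‖ ^ 2 / 8 * (2 * t))) t := by
      simpa using ((hasDerivAt_pow 2 t).const_mul (‖q‖ ^ 2 / 8)).exp
    refine (h5.ofReal_comp.fun_mul (h1 t)).congr_deriv ?_
    push_cast
    ring
  have h6 := is_const_of_deriv_eq_zero (fun t => (h4 t).differentiableAt) (fun t => (h4 t).deriv) 1 0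
  simp only [hV, one_smul, zero_smul, testShift_zero] at h6
  rw [Real.exp_neg, Complex.ofReal_inv, eq_inv_mul_iff_mul_eq₀
    (by exact_mod_cast (Real.exp_pos _).ne')]
  simpa using h6

/-- `e^{i q·r}` is the magnetic translation followed by undoing its drift. The magnetic translation
is moved to the left by unitarity; it does not displace `a`, so the kernel of `a` is preserved and
the cyclotron factor can be evaluated there. -/
theorem testForm_planeWave (q : Plane) {f h : Test} (hf : ladder 1 1 f = 0)
    (hh : ladder 1 1 h = 0) : testForm f (testShift q 0 h) =
      ((Real.exp (-(‖q‖ ^ 2 / 8)) : ℝ) : ℂ) *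
        testForm f (testShift ((1 / 2 : ℝ) • q) (drift q) h) := by
  set W : ℝ → Test → Test := fun t => testShift (t • ((1 / 2 : ℝ) • q)) (t • drift q) with hW
  have h1 : W (-1) (testShift q 0 h) = testShift ((1 / 2 : ℝ) • q) (-drift q) h := by
    ext r
    simp only [hW, testShift_apply, ← mul_assoc, ← Complex.exp_add, neg_one_smul, inner_add_right,
      inner_neg_left, inner_neg_right, real_inner_smul_left, inner_drift, add_zero]
    congr 2
    push_cast
    ring
  have h2 : W 1 (W (-1) f) = f := by
    simp only [hW]
    rw [← testShift_add (inner_half_drift q), add_neg_cancel, zero_smul, zero_smul, testShift_zero]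
  have h3 : ladder 1 1 (W (-1) f) = 0 := by
    simp only [hW]
    rw [ladder_testShift, hf, displacement_half_drift, map_zero, zero_smul, zero_add]
  have h4 : W 1 h = testShift ((1 / 2 : ℝ) • q) (drift q) h := by simp only [hW, one_smul]
  calc testForm f (testShift q 0 h) = testForm (W (-1) f) (W (-1) (testShift q 0 h)) :=
        (testForm_testShift_testShift _ _ _ _).symm
    _ = _ * testForm (W (-1) f) h := by rw [h1, testForm_cyclotron_shift q h3 hh]
    _ = _ * testForm (W 1 (W (-1) f)) (W 1 h) := by
      congr 1
      exact (testForm_testShift_testShift _ _ _ _).symm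
    _ = _ := by rw [h2, h4]

/-! ### Matrix elements and the operator identities -/

theorem lower_state_zero (m : ℕ) : ladder 1 1 (state 0 m) = 0 := by
  rw [state, map_smul, lower_rawState, Nat.cast_zero, zero_smul, smul_zero]

theorem state_eq (n m : ℕ) : state n m =
    (((Real.sqrt (n.factorial : ℝ))⁻¹ : ℝ) : ℂ) • ((ladder (-1) (-1)) ^ n) (state 0 m) := by
  rw [state, state, map_smul, smul_smul]
  simp only [rawState, pow_zero, Module.End.one_apply]
  simp

/-- The abstract ladder computation with `E` the plane wave; the `n!` it produces cancels the
normalization of the two states. -/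
theorem testForm_state_planeWave (q : Plane) (n j m : ℕ) :
    testForm (state n j) (testShift q 0 (state n m)) =
      ((laguerre n (‖q‖ ^ 2 / 4) : ℝ) : ℂ) * testForm (state 0 j) (testShift q 0 (state 0 m)) := by
  have ha : ∀ (σ τ : ℝ) f g, testForm (ladder σ τ f) g = testForm f (ladder (-σ) (-τ) g) :=
    testForm_ladder
  have h1 : displacement 1 1 q 0 = waveDisplacement q := by
    simp only [displacement, waveDisplacement, PiLp.zero_apply]
    push_cast
    ring_nf
    simp only [Complex.I_sq]
    ring
  have h2 : displacement (-1) (-1) q 0 = starRingEnd ℂ (waveDisplacement q) := by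
    simp only [displacement, conj_waveDisplacement, PiLp.zero_apply]
    push_cast
    ring_nf
    simp only [Complex.I_sq]
    ring
  have h3 := form_raise_pow_displaced_raise_pow (s := testForm) (E := testShift q 0)
    (c := waveDisplacement q) comm_cyclotron
    (fun f g => by simpa using ha (-1) (-1) f g) (fun f g => by simpa using ha 1 1 f g)
    (fun f => by rw [ladder_testShift, h1]) (fun f => by rw [ladder_testShift, h2])
    (lower_state_zero j) (lower_state_zero m) n
  rw [normSq_waveDisplacement] at h3
  have hs : ∀ (c : ℝ) (f g : Test), testForm ((c : ℂ) • f) ((c : ℂ) • g) =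
      (c : ℂ) ^ 2 * testForm f g := by
    intro c f g
    rw [testForm_apply, toLp_smul, toLp_smul, inner_smul_left, inner_smul_right, Complex.conj_ofReal,
      ← testForm_apply]
    ring
  rw [state_eq n j, state_eq n m, (testShift q 0).map_smul, hs, h3, ← sqrt_factorial_sq]
  have h4 := sqrt_factorial_ne_zero n
  push_cast
  field_simp

theorem inner_levelState_compress (n j m : ℕ) (T : L2Plane →L[ℂ] L2Plane) :
    inner ℂ (levelState n j) (compress n T (levelState n m)) =
      inner ℂ (stateL2 (n, j)) (T (stateL2 (n, m))) :=
  Submodule.inner_orthogonalProjectionOnto_eq_of_mem_left (levelState n j) _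

theorem inner_levelState_smul_compress (n j m : ℕ) (c : ℂ) (T : L2Plane →L[ℂ] L2Plane) :
    inner ℂ (levelState n j) ((c • compress n T) (levelState n m)) =
      c * inner ℂ (stateL2 (n, j)) (T (stateL2 (n, m))) := by
  rw [smul_apply, inner_smul_right, inner_levelState_compress]

theorem inner_stateL2_planeWave (q : Plane) (n j m : ℕ) :
    inner ℂ (stateL2 (n, j)) (planeWave q (stateL2 (n, m))) =
      testForm (state n j) (testShift q 0 (state n m)) := by
  rw [stateL2, stateL2, planeWave_toLp, testForm_apply]

theorem clm_ext_levelState {n : ℕ} {P Q : level n →L[ℂ] level n}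
    (h : ∀ j m, inner ℂ (levelState n j) (P (levelState n m)) =
      inner ℂ (levelState n j) (Q (levelState n m))) : P = Q := by
  refine ContinuousLinearMap.ext_on (dense_span_levelState n) ?_
  rintro _ ⟨m, rfl⟩
  refine (levelBasis n).repr.injective ?_
  ext j
  rw [HilbertBasis.repr_apply_apply, HilbertBasis.repr_apply_apply, coe_levelBasis]
  exact h j m

theorem compress_magneticTranslation (q : Plane) (c : ℝ) :
    ((c * Real.exp (-(‖q‖ ^ 2 / 8)) : ℝ) : ℂ) • compress 0 (magneticTranslation q 1) =
      (c : ℂ) • compress 0 (planeWave q) := by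
  refine clm_ext_levelState fun j m => ?_
  rw [inner_levelState_smul_compress, inner_levelState_smul_compress, inner_stateL2_planeWave,
    stateL2, stateL2, magneticTranslation, one_smul, one_smul, shift_toLp, ← testForm_apply,
    testForm_planeWave q (lower_state_zero j) (lower_state_zero m), Complex.ofReal_mul, mul_assoc]

theorem conj_ladderUnitary_compress_planeWave (n : ℕ) (q : Plane) :
    ((ladderUnitary n).toContinuousLinearEquiv : level n →L[ℂ] level 0) ∘L
      compress n (planeWave q) ∘L
        ((ladderUnitary n).symm.toContinuousLinearEquiv : level 0 →L[ℂ] level n) =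
      ((laguerre n (‖q‖ ^ 2 / 4) : ℝ) : ℂ) • compress 0 (planeWave q) := by
  refine clm_ext_levelState fun j m => ?_
  have h1 : ∀ m, (ladderUnitary n).symm (levelState 0 m) = levelState n m := fun m => by
    rw [← ladderUnitary_levelState n m, LinearIsometryEquiv.symm_apply_apply]
  have h2 : ∀ x : level n, inner ℂ (levelState 0 j) (ladderUnitary n x) =
      inner ℂ (levelState n j) x := fun x => by
    have h := (ladderUnitary n).inner_map_map (levelState n j) x
    rwa [ladderUnitary_levelState] at h
  refine (h2 (compress n (planeWave q) ((ladderUnitary n).symm (levelState 0 m)))).trans ?_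
  rw [h1]
  refine (inner_levelState_compress n j m _).trans
    (Eq.trans ?_ (inner_levelState_smul_compress 0 j m _ _).symm)
  rw [inner_stateL2_planeWave, inner_stateL2_planeWave, testForm_state_planeWave]

end LandauLevels

theorem mainTheorem7 (n : ℕ) (q : Plane) :
    (∃! U : level n ≃ₗᵢ[ℂ] level 0, IsLadderUnitary n U) ∧
    (∃! W : ℝ → L2Plane →L[ℂ] L2Plane, IsExpGroup (dotGuiding q) W) ∧
    ∀ (U : level n ≃ₗᵢ[ℂ] level 0) (W : ℝ → L2Plane →L[ℂ] L2Plane),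
      IsLadderUnitary n U → IsExpGroup (dotGuiding q) W →
        (U.toContinuousLinearEquiv : level n →L[ℂ] level 0) ∘L compress n (planeWave q) ∘L
            (U.symm.toContinuousLinearEquiv : level 0 →L[ℂ] level n) =
          ((laguerre n (‖q‖ ^ 2 / 4) * Real.exp (-(‖q‖ ^ 2 / 8)) : ℝ) : ℂ) •
            compress 0 (W 1) ∧
        ((laguerre n (‖q‖ ^ 2 / 4) * Real.exp (-(‖q‖ ^ 2 / 8)) : ℝ) : ℂ) •
            compress 0 (W 1) =
          ((laguerre n (‖q‖ ^ 2 / 4) : ℝ) : ℂ) • compress 0 (planeWave q) := by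
  refine ⟨?_, ?_, ?_⟩
  · exact ⟨ladderUnitary n, isLadderUnitary_ladderUnitary n, fun U hU =>
      hU.unique (isLadderUnitary_ladderUnitary n)⟩
  · exact ⟨magneticTranslation q, isExpGroup_magneticTranslation q, fun W hW =>
      hW.eq_magneticTranslation⟩
  intro U W hU hW
  rw [hU.unique (isLadderUnitary_ladderUnitary n), hW.eq_magneticTranslation]
  have h := compress_magneticTranslation q (laguerre n (‖q‖ ^ 2 / 4))
  exact ⟨(conj_ladderUnitary_compress_planeWave n q).trans h.symm, h⟩
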